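/- Let $c$ be irrational and let $p_n/q_n$ ($p_n\in\mathbb Z$, $q_n\ge 1$, $\gcd(p_n,q_n)=1$) satisfy $0<c-p_n/q_n=\beta_n/q_n^2$ with $\beta_n\to0$. Let $T_t(x,y)=(x+t,\,y+ct)$ be the winding of the torus $M=\mathbb R^2/\mathbb Z^2$ along $(1,c)$, and put $A(f,t,z)=\frac1t\int_0^t f(T_sz)\,ds$. Let $\varphi(t)\to+0$ as $t\to+\infty$. *Construction.* Write $\ell_n=q_n\sqrt{1+c^2}$. For $x_n\in\mathbb R$, $y_n\in\mathbb R$ let $(x_n,y_n)$ denote the point $(0,x_n)+\frac{y_n}{\sqrt{1+c^2}}(1,c)$ of $M$, and let $R_n$ be the parallelogram $0\le x_n\le(1-\beta_n)/q_n$, $0\le y_n\le \ell_n$ (of area $1-\beta_n$), divided into four consecutive equal quarters by the lines $y_n=\ell_n/4,\ \ell_n/2,\ 3\ell_n/4$. Let $a_n>0$, $\delta_n>0$, $\delta_n\to0$, $t_n=\delta_nq_n\sqrt{1+c^2}$, and $$\sum_n a_n<\infty,\qquad \sum_{m>n}a_m=\alpha_na_n\ \text{ with }\ \alpha_n\to0,\qquad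 \frac{\sum_{m<n}q_m}{q_na_n\delta_n}\to0,\qquad \frac{a_n\alpha_n}{\varphi(t_n)}\to+\infty .$$ Let $f_n:M\to\mathbb R$ be $C^\infty$ functions with $|f_n|\le a_n$ such that $f_n$ vanishes outside $R_n$ and on its boundary; on the first quarter $f_n\ge0$, and $f_n=a_n$ on a compact subset of the interior of that quarter whose area tends to $1/4$ as $n\to\infty$; $f_n=0$ on the second and fourth quarters; $f_n(x_n,y_n+\ell_n/2)=-f_n(x_n,y_n)$ for $(x_n,y_n)$ in the first quarter; and $\int_0^{\ell_n}f_n(x_n,y_n)\,dy_n=0$ for every $x_n\in[0,(1-\beta_n)/q_n]$. Put $f=\sum_n f_n$. *Theorem.* (a) For every $c$, $(p_n/q_n)$ and $\varphi$ as above, after passing to a subsequence of $(p_n/q_n)$ there are $a_n,\delta_n,f_n$ satisfying all these conditions. (b) Whenever all these conditions hold, $f$ is continuous on $M$, and for almost every $z\in M$ $$\limsup_{t\to+\infty}\frac{1}{\varphi(t)}\,|A(f,t,z)|=+\infty .$$ -/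

import Mathlib

open Set Filter Topology MeasureTheory
open scoped ContDiff

noncomputable section

namespace TorusWinding

/-- The two-dimensional torus `ℝ² / ℤ²`; `volume` on it is the normalized Lebesgue measure. -/
abbrev Torus : Type := UnitAddCircle × UnitAddCircle

/-- The winding of the torus along the vector `(1, c)`: `T_t (x, y) = (x + t, y + c t)`. -/
def flow (c t : ℝ) (z : Torus) : Torus :=
  (z.1 + ((t : ℝ) : UnitAddCircle), z.2 + ((c * t : ℝ) : UnitAddCircle))

/-- The time average `A(f, t, z) = (1 / t) ∫_0^t f (T_s z) ds`. -/
def timeAverage (c : ℝ) (f : Torus → ℝ) (t : ℝ) (z : Torus) : ℝ :=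
  (1 / t) * ∫ s in (0 : ℝ)..t, f (flow c s z)

/-- The fractions `p n / q n` are in lowest terms with positive denominators, and
`0 < c - p n / q n = o(1 / (q n) ^ 2)`. -/
structure IsApproximation (c : ℝ) (p : ℕ → ℤ) (q : ℕ → ℕ) : Prop where
  pos : ∀ n, 0 < q n
  coprime : ∀ n, IsCoprime (p n) (q n : ℤ)
  lt : ∀ n, 0 < c - (p n : ℝ) / (q n : ℝ)
  isLittleO : (fun n => c - (p n : ℝ) / (q n : ℝ)) =o[atTop] (fun n => 1 / (q n : ℝ) ^ 2)

/-- `β = q² (c - p / q)`. -/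
def beta (c : ℝ) (p : ℤ) (q : ℕ) : ℝ := (q : ℝ) ^ 2 * (c - (p : ℝ) / (q : ℝ))

/-- The point of the torus with coordinates `w = (x, y)`: start at the point at height `x` on the
side parallel to the second axis and move the distance `y` along the direction `(1, c)`. -/
def chart (c : ℝ) (w : ℝ × ℝ) : Torus :=
  (((w.2 / √(1 + c ^ 2) : ℝ) : UnitAddCircle),
    ((w.1 + c * (w.2 / √(1 + c ^ 2)) : ℝ) : UnitAddCircle))

/-- The width `(1 - β) / q` of the parallelogram `R`, measured along the second axis.
In the parallelogram `M` spanned by `(0, 1 / q)` and `(q, p)`, the segments of direction `(1, c)`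
that start on the left side at heights in `[0, (1 - β) / q]` are those that run through all of `M`
and end on its right side. -/
def width (c : ℝ) (p : ℤ) (q : ℕ) : ℝ := (1 - beta c p q) / q

/-- The length `q √(1 + c²)` of the parallelogram `R` along the flow. -/
def length (c : ℝ) (q : ℕ) : ℝ := q * √(1 + c ^ 2)

/-- The parallelogram `R` in the coordinates `(x, y)` of `chart c`. -/
def parallelogram (c : ℝ) (p : ℤ) (q : ℕ) : Set (ℝ × ℝ) :=
  Icc 0 (width c p q) ×ˢ Icc 0 (length c q)

/-- The four successive quarters of `R` along the flow, `i = 0, 1, 2, 3`,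
in the coordinates `(x, y)`. -/
def quarter (c : ℝ) (p : ℤ) (q : ℕ) (i : ℕ) : Set (ℝ × ℝ) :=
  Icc 0 (width c p q) ×ˢ Icc (i * (length c q / 4)) ((i + 1) * (length c q / 4))

/-- `g` is a smooth function on the torus with `|g| ≤ a`, nonnegative on the first quarter of `R`,
zero on the second and the fourth quarter, on the third quarter minus its copy on the first one,
zero on the boundary of `R` and outside of `R`, with zero integral along each fibre of `R`. -/
structure IsBump (c : ℝ) (p : ℤ) (q : ℕ) (a : ℝ) (g : Torus → ℝ) : Prop where
  smooth : ContDiff ℝ ∞ (fun w : ℝ × ℝ => g ((w.1 : UnitAddCircle), (w.2 : UnitAddCircle)))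
  abs_le : ∀ z, |g z| ≤ a
  eq_zero : ∀ z, z ∉ chart c '' interior (parallelogram c p q) → g z = 0
  first : ∀ w ∈ quarter c p q 0, 0 ≤ g (chart c w)
  second : ∀ w ∈ quarter c p q 1, g (chart c w) = 0
  third : ∀ w ∈ quarter c p q 0, g (chart c (w.1, w.2 + length c q / 2)) = -g (chart c w)
  fourth : ∀ w ∈ quarter c p q 3, g (chart c w) = 0
  fibre : ∀ x ∈ Icc 0 (width c p q), ∫ y in (0 : ℝ)..length c q, g (chart c (x, y)) = 0

/-- `α_n = (∑_{m > n} a_m) / a_n`. -/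
def tailRatio (a : ℕ → ℝ) (n : ℕ) : ℝ := (∑' m, a (n + 1 + m)) / a n

/-- `t_n = δ_n q_n √(1 + c²)`. -/
def time (c : ℝ) (q : ℕ → ℕ) (δ : ℕ → ℝ) (n : ℕ) : ℝ := δ n * q n * √(1 + c ^ 2)

/-- The amplitudes `a`, the numbers `δ` and the functions `f n` are admissible for the rate `φ`. -/
structure IsConstruction (c : ℝ) (p : ℕ → ℤ) (q : ℕ → ℕ) (φ : ℝ → ℝ)
    (a δ : ℕ → ℝ) (f : ℕ → Torus → ℝ) : Prop where
  amp_pos : ∀ n, 0 < a n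
  amp_summable : Summable a
  amp_tail : Tendsto (tailRatio a) atTop (𝓝 0)
  delta_pos : ∀ n, 0 < δ n
  delta_tendsto : Tendsto δ atTop (𝓝 0)
  growth : Tendsto (fun n => (∑ m ∈ Finset.range n, (q m : ℝ)) / (q n * a n * δ n)) atTop (𝓝 0)
  rate : Tendsto (fun n => a n * tailRatio a n / φ (time c q δ n)) atTop atTop
  bump : ∀ n, IsBump c (p n) (q n) (a n) (f n)
  -- `f n = a n` on a set in the first quarter, separated from its boundary, of area close to `1/4`
  plateau : ∃ K : ℕ → Set (ℝ × ℝ),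
    (∀ n, IsCompact (K n) ∧ K n ⊆ interior (quarter c (p n) (q n) 0) ∧
      ∀ w ∈ K n, f n (chart c w) = a n) ∧
    Tendsto (fun n => (volume : Measure Torus).real (chart c '' K n)) atTop (𝓝 (1 / 4))

end TorusWinding

end

namespace TorusWinding

/-! ### The flow -/

/-! At time `t_n` the orbit integral of `f` is governed by the single bump `f_n`. Each earlier bump
has zero integral over every full crossing of its parallelogram, so its orbit integral never exceeds
`2 a_m q_m` (`IsBump.abs_integral_flow_le`); by the growth condition the sum of these bounds is
negligible against `t_n a_n`. The later bumps contribute at most `t_n a_n α_n`. Since `t_n` is short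
compared with a quarter of `R_n`, most orbits starting in the first quarter stay there up to time
`t_n`, and an occupation-time count (`IsBump.volume_plateau_le`) shows that on a set of measure at
least `1/32` the bump `f_n` itself contributes at least `t_n a_n / 2`. On that set the average of
`f` is at least `a_n / 4` for large `n`.

Continuity from above yields a set of positive measure where this happens infinitely often. Allowing
an arbitrary constant in place of `1/4` makes the set flow invariant, because a time shift changes
integrals by a bounded amount while `t_n a_n → ∞`; ergodicity then gives full measure. Finally `a_n
/ φ(t_n) → ∞`.

For existence, amplitudes `2^(-n²)` and `δ_n = 1/(n+1)` are fixed in advance. All remaining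
conditions hold once the denominators grow fast enough, so a sparse subsequence suffices; the bumps
are products of smooth cutoffs carried to the torus by the chart. -/

lemma sqrt_one_add_sq_pos (c : ℝ) : 0 < √(1 + c ^ 2) := by positivity

lemma flow_chart (c s x y : ℝ) :
    flow c s (chart c (x, y)) = chart c (x, y + s * √(1 + c ^ 2)) := by
  have h := (sqrt_one_add_sq_pos c).ne'
  have e : (y + s * √(1 + c ^ 2)) / √(1 + c ^ 2) = y / √(1 + c ^ 2) + s := by field_simp
  simp only [flow, chart, e, ← AddCircle.coe_add]
  congr 2
  ring

lemma flow_flow (c s t : ℝ) (z : Torus) : flow c s (flow c t z) = flow c (t + s) z := by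
  simp only [flow, mul_add, AddCircle.coe_add, add_assoc]

lemma flow_zero (c : ℝ) (z : Torus) : flow c 0 z = z := by
  simp [flow]

lemma continuous_coe : Continuous ((↑) : ℝ → UnitAddCircle) :=
  AddCircle.continuous_mk' 1

lemma continuous_flow (c : ℝ) : Continuous fun w : ℝ × Torus => flow c w.1 w.2 := by
  have := continuous_coe
  unfold flow
  fun_prop

lemma continuous_chart (c : ℝ) : Continuous (chart c) := by
  have := continuous_coe
  unfold chart
  fun_prop

instance : (volume : Measure Torus).IsAddHaarMeasure :=
  inferInstanceAs ((volume : Measure UnitAddCircle).prod volume).IsAddHaarMeasure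

instance : IsProbabilityMeasure (volume : Measure UnitAddCircle) := ⟨UnitAddCircle.measure_univ⟩

instance : IsProbabilityMeasure (volume : Measure Torus) :=
  inferInstanceAs (IsProbabilityMeasure ((volume : Measure UnitAddCircle).prod volume))

lemma measurePreserving_flow (c t : ℝ) : MeasurePreserving (flow c t) volume volume :=
  measurePreserving_add_right volume
    (((t : ℝ) : UnitAddCircle), ((c * t : ℝ) : UnitAddCircle))

/-! ### Ergodicity -/

/-- The orbit of `0` meets the vertical circle over `x` at the times `x + k`, in a translate of the
multiples of `c`, which are dense in the circle. -/
lemma dense_setOf_flow_zero {c : ℝ} (hc : Irrational c) :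
    Dense (range fun t : ℝ => flow c t 0) := by
  rw [dense_iff_inter_open]
  rintro U hU ⟨⟨x, y⟩, hxy⟩
  obtain ⟨x, rfl⟩ := QuotientAddGroup.mk_surjective x
  have hd : DenseRange (· • (c : UnitAddCircle) : ℤ → UnitAddCircle) :=
    AddCircle.denseRange_zsmul_coe_iff.2 (by simpa using hc)
  let V : Set UnitAddCircle :=
    (fun v => ((x : UnitAddCircle), v + ((c * x : ℝ) : UnitAddCircle))) ⁻¹' U
  have hV : IsOpen V := hU.preimage (by fun_prop)
  obtain ⟨k, hk⟩ := hd.exists_mem_open hV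
    ⟨y - ((c * x : ℝ) : UnitAddCircle), by simpa [V] using hxy⟩
  refine ⟨flow c (x + k) 0, ?_, mem_range_self _⟩
  have hk' : ((k : ℝ) : UnitAddCircle) = 0 := by
    rw [AddCircle.coe_eq_zero_iff]
    exact ⟨k, by simp⟩
  have e : ((c * (x + k) : ℝ) : UnitAddCircle) =
      k • (c : UnitAddCircle) + ((c * x : ℝ) : UnitAddCircle) := by
    rw [← AddCircle.coe_zsmul, ← AddCircle.coe_add]
    congr 1
    simp
    ring
  simpa [flow, e, hk', V] using hk

/-- The winding with an irrational slope is ergodic. -/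
lemma ae_mem_of_flow_invariant {c : ℝ} (hc : Irrational c) {s : Set Torus}
    (hs : MeasurableSet s) (hinv : ∀ t z, z ∈ s → flow c t z ∈ s) (h0 : volume s ≠ 0) :
    ∀ᵐ z : Torus, z ∈ s := by
  -- The torus acts ergodically on itself by translations, and invariance under the dense set of
  -- translations `flow c t 0` already suffices.
  have : ErgodicVAdd Torus Torus volume := instErgodicVAddOfIsAddLeftInvariant
  have hconst : EventuallyConst s (ae (volume : Measure Torus)) := by
    refine aeconst_of_dense_setOfPred_preimage_vadd_eq (M := Torus) hs.nullMeasurableSet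
      ((dense_setOf_flow_zero hc).mono ?_)
    rintro _ ⟨t, rfl⟩
    have key : ∀ z : Torus, flow c t 0 +ᵥ z = flow c t z := by
      intro z
      simp [flow, add_comm, Prod.ext_iff]
    ext z
    simp only [mem_preimage, key]
    refine ⟨fun h => ?_, hinv t z⟩
    have := hinv (-t) _ h
    rwa [flow_flow, add_neg_cancel, flow_zero] at this
  rcases eventuallyConst_set'.1 hconst with h | h
  · exact absurd (by simpa using measure_congr h) h0
  · filter_upwards [h.mem_iff] with z hz using by simpa using hz

/-! ### Measure of images under the projection of the plane -/

/-- The projection of the plane to the torus. -/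
def proj (w : ℝ × ℝ) : Torus := ((w.1 : UnitAddCircle), (w.2 : UnitAddCircle))

lemma continuous_proj : Continuous proj := by
  have := continuous_coe
  unfold proj
  fun_prop

lemma proj_eq_iff {v w : ℝ × ℝ} :
    proj v = proj w ↔ ∃ i j : ℤ, v = (w.1 + i, w.2 + j) := by
  have key : ∀ x y : ℝ, (x : UnitAddCircle) = y ↔ ∃ i : ℤ, x = y + i := by
    intro x y
    rw [← sub_eq_zero, ← AddCircle.coe_sub, AddCircle.coe_eq_zero_iff]
    refine exists_congr fun i => ?_
    simp only [zsmul_eq_mul, mul_one]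
    constructor <;> intro h <;> linarith
  simp only [proj, Prod.ext_iff, key]
  exact ⟨fun ⟨⟨i, hi⟩, ⟨j, hj⟩⟩ => ⟨i, j, hi, hj⟩, fun ⟨i, j, hi, hj⟩ => ⟨⟨i, hi⟩, ⟨j, hj⟩⟩⟩

/-- The half-open unit square with lower left vertex `(i, j)`. -/
def box (k : ℤ × ℤ) : Set (ℝ × ℝ) := Ioc (k.1 : ℝ) (k.1 + 1) ×ˢ Ioc (k.2 : ℝ) (k.2 + 1)

lemma measurableSet_box (k : ℤ × ℤ) : MeasurableSet (box k) :=
  measurableSet_Ioc.prod measurableSet_Ioc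

lemma injOn_proj_box (k : ℤ × ℤ) : InjOn proj (box k) := by
  rintro ⟨x, y⟩ ⟨⟨hx1, hx2⟩, hy1, hy2⟩ ⟨x', y'⟩ ⟨⟨hx1', hx2'⟩, hy1', hy2'⟩ h
  obtain ⟨i, j, h⟩ := proj_eq_iff.1 h
  simp only [Prod.mk.injEq] at *
  obtain ⟨rfl, rfl⟩ := h
  have hi : i = 0 := by
    have h1 : (i : ℝ) < 1 := by linarith
    have h2 : (-1 : ℝ) < i := by linarith
    have h1' : i < 1 := by exact_mod_cast h1
    have h2' : -1 < i := by exact_mod_cast h2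
    omega
  have hj : j = 0 := by
    have h1 : (j : ℝ) < 1 := by linarith
    have h2 : (-1 : ℝ) < j := by linarith
    have h1' : j < 1 := by exact_mod_cast h1
    have h2' : -1 < j := by exact_mod_cast h2
    omega
  simp [hi, hj]

lemma iUnion_box : ⋃ k, box k = univ := by
  refine eq_univ_of_forall fun w => mem_iUnion.2 ⟨(⌈w.1⌉ - 1, ⌈w.2⌉ - 1), ?_⟩
  have h1 := Int.ceil_lt_add_one w.1
  have h2 := Int.le_ceil w.1
  have h3 := Int.ceil_lt_add_one w.2
  have h4 := Int.le_ceil w.2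
  refine ⟨⟨?_, ?_⟩, ?_, ?_⟩ <;> push_cast <;> linarith

lemma pairwise_disjoint_box : Pairwise (Function.onFun Disjoint box) := by
  rintro ⟨i, j⟩ ⟨i', j'⟩ hne
  refine Set.disjoint_left.2 ?_
  rintro ⟨x, y⟩ ⟨⟨hx1, hx2⟩, hy1, hy2⟩ ⟨⟨hx1', hx2'⟩, hy1', hy2'⟩
  simp only at *
  apply hne
  have h1 : (i : ℝ) < i' + 1 := by linarith
  have h2 : (i' : ℝ) < i + 1 := by linarith
  have h3 : (j : ℝ) < j' + 1 := by linarith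
  have h4 : (j' : ℝ) < j + 1 := by linarith
  norm_cast at h1 h2 h3 h4
  ext <;> simp only <;> omega

lemma measurePreserving_proj_box (k : ℤ × ℤ) :
    MeasurePreserving proj (volume.restrict (box k)) volume := by
  have h := (UnitAddCircle.measurePreserving_mk (k.1 : ℝ)).prod
    (UnitAddCircle.measurePreserving_mk (k.2 : ℝ))
  rw [Measure.prod_restrict] at h
  exact h

/-- Injective continuous images of Borel sets are Borel; cutting by a unit box supplies the
injectivity. -/
lemma measurableSet_proj_image_inter_box {A : Set (ℝ × ℝ)} (hA : MeasurableSet A) (k : ℤ × ℤ) :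
    MeasurableSet (proj '' (A ∩ box k)) :=
  (hA.inter (measurableSet_box k)).image_of_continuousOn_injOn continuous_proj.continuousOn
    ((injOn_proj_box k).mono inter_subset_right)

lemma volume_proj_image_inter_box {A : Set (ℝ × ℝ)} (hA : MeasurableSet A) (k : ℤ × ℤ) :
    volume (proj '' (A ∩ box k)) = volume (A ∩ box k) := by
  have hm := measurableSet_proj_image_inter_box hA k
  rw [← (measurePreserving_proj_box k).measure_preimage hm.nullMeasurableSet,
    Measure.restrict_apply (continuous_proj.measurable hm)]
  congr 1
  ext w
  constructor
  · rintro ⟨⟨v, ⟨hvA, hvk⟩, hv⟩, hw⟩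
    exact (injOn_proj_box k hvk hw hv) ▸ ⟨hvA, hvk⟩
  · rintro ⟨h1, h2⟩
    exact ⟨mem_image_of_mem _ ⟨h1, h2⟩, h2⟩

lemma tsum_volume_inter_box {A : Set (ℝ × ℝ)} (hA : MeasurableSet A) :
    ∑' k, volume (A ∩ box k) = volume A := by
  rw [← measure_iUnion, ← inter_iUnion, iUnion_box, inter_univ]
  · exact fun i j h => (pairwise_disjoint_box h).mono inter_subset_right inter_subset_right
  · exact fun k => hA.inter (measurableSet_box k)

lemma proj_image_eq_iUnion (A : Set (ℝ × ℝ)) : proj '' A = ⋃ k, proj '' (A ∩ box k) := by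
  rw [← image_iUnion, ← inter_iUnion, iUnion_box, inter_univ]

lemma volume_proj_image_le {A : Set (ℝ × ℝ)} (hA : MeasurableSet A) :
    volume (proj '' A) ≤ volume A := by
  rw [proj_image_eq_iUnion, ← tsum_volume_inter_box hA]
  exact (measure_iUnion_le _).trans_eq (tsum_congr fun k => volume_proj_image_inter_box hA k)

lemma volume_proj_image {A : Set (ℝ × ℝ)} (hA : MeasurableSet A) (hinj : InjOn proj A) :
    volume (proj '' A) = volume A := by
  rw [proj_image_eq_iUnion, ← tsum_volume_inter_box hA, measure_iUnion]
  · exact tsum_congr fun k => volume_proj_image_inter_box hA k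
  · intro i j h
    refine (disjoint_image_image ?_)
    intro v hv w hw hvw
    obtain rfl := hinj hv.1 hw.1 hvw
    exact Set.disjoint_left.1 (pairwise_disjoint_box h) hv.2 hw.2
  · exact fun k => measurableSet_proj_image_inter_box hA k

/-! ### The charts -/

/-- The linear map of the plane that lifts `chart c`. -/
noncomputable def lift (c : ℝ) : (ℝ × ℝ) →ₗ[ℝ] (ℝ × ℝ) :=
  Matrix.toLin (Module.Basis.finTwoProd ℝ) (Module.Basis.finTwoProd ℝ)
    !![0, 1 / √(1 + c ^ 2); 1, c / √(1 + c ^ 2)]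

lemma lift_apply (c : ℝ) (w : ℝ × ℝ) :
    lift c w = (w.2 / √(1 + c ^ 2), w.1 + c * (w.2 / √(1 + c ^ 2))) := by
  rw [lift, Matrix.toLin_finTwoProd_apply]
  ext <;> simp <;> ring

lemma proj_lift (c : ℝ) (w : ℝ × ℝ) : proj (lift c w) = chart c w := by
  rw [lift_apply]
  rfl

lemma volume_lift_image (c : ℝ) (A : Set (ℝ × ℝ)) :
    volume (lift c '' A) = ENNReal.ofReal (1 / √(1 + c ^ 2)) * volume A := by
  rw [Measure.addHaar_image_linearMap, lift, LinearMap.det_toLin, Matrix.det_fin_two_of]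
  congr 2
  rw [zero_mul, zero_sub, mul_one, abs_neg, abs_of_pos (by positivity)]

/-- The inverse of `lift c`. -/
noncomputable def unlift (c : ℝ) (v : ℝ × ℝ) : ℝ × ℝ := (v.2 - c * v.1, v.1 * √(1 + c ^ 2))

lemma lift_unlift (c : ℝ) (v : ℝ × ℝ) : lift c (unlift c v) = v := by
  have := (sqrt_one_add_sq_pos c).ne'
  rw [lift_apply]
  simp only [unlift]
  ext <;> simp only <;> field_simp
  ring

lemma unlift_lift (c : ℝ) (w : ℝ × ℝ) : unlift c (lift c w) = w := by
  have := (sqrt_one_add_sq_pos c).ne'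
  rw [lift_apply]
  simp only [unlift]
  ext <;> simp only <;> field_simp
  ring

lemma chart_image (c : ℝ) (A : Set (ℝ × ℝ)) : chart c '' A = proj '' (lift c '' A) := by
  rw [image_image]
  exact image_congr fun w _ => (proj_lift c w).symm

lemma volume_Icc_prod (a b x y : ℝ) :
    (volume : Measure (ℝ × ℝ)) (Icc a b ×ˢ Icc x y) =
      ENNReal.ofReal (b - a) * ENNReal.ofReal (y - x) := by
  rw [Measure.volume_eq_prod, Measure.prod_prod, Real.volume_Icc, Real.volume_Icc]

lemma isCompact_chart_image (c a b x y : ℝ) : IsCompact (chart c '' (Icc a b ×ˢ Icc x y)) :=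
  (isCompact_Icc.prod isCompact_Icc).image (continuous_chart c)

lemma measurableSet_lift_image_rect (c a b x y : ℝ) :
    MeasurableSet (lift c '' (Icc a b ×ˢ Icc x y)) :=
  ((isCompact_Icc.prod isCompact_Icc).image
    (lift c).continuous_of_finiteDimensional).measurableSet

/-- Injectivity is not required: the bound is also applied to rectangles that stick out of `R`. -/
lemma volume_chart_rect_le (c : ℝ) {w x y : ℝ} :
    volume (chart c '' (Icc 0 w ×ˢ Icc x y)) ≤
      ENNReal.ofReal w * ENNReal.ofReal ((y - x) / √(1 + c ^ 2)) := by
  rw [chart_image]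
  refine (volume_proj_image_le (measurableSet_lift_image_rect ..)).trans_eq ?_
  rw [volume_lift_image, volume_Icc_prod, sub_zero, mul_left_comm,
    ← ENNReal.ofReal_mul (by positivity)]
  congr 2
  ring

lemma volume_chart_rect (c : ℝ) {a b x y : ℝ} (hab : a ≤ b)
    (hinj : InjOn (chart c) (Icc a b ×ˢ Icc x y)) :
    volume (chart c '' (Icc a b ×ˢ Icc x y)) =
      ENNReal.ofReal ((b - a) * (y - x) / √(1 + c ^ 2)) := by
  have := sub_nonneg.2 hab
  rw [chart_image, volume_proj_image (measurableSet_lift_image_rect ..), volume_lift_image,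
    volume_Icc_prod, ← ENNReal.ofReal_mul (by positivity), ← ENNReal.ofReal_mul (by positivity)]
  · congr 1
    ring
  · rintro _ ⟨v, hv, rfl⟩ _ ⟨w, hw, rfl⟩ h
    rw [proj_lift, proj_lift] at h
    rw [hinj hv hw h]

/-! ### Injectivity of the chart on the parallelogram -/

lemma beta_pos {c : ℝ} {p : ℤ} {q : ℕ} (hq : 0 < q) (h : 0 < c - (p : ℝ) / q) :
    0 < beta c p q := by
  unfold beta
  positivity

lemma interior_parallelogram (c : ℝ) (p : ℤ) (q : ℕ) :
    interior (parallelogram c p q) = Ioo 0 (width c p q) ×ˢ Ioo 0 (length c q) := by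
  rw [parallelogram, interior_prod_eq, interior_Icc, interior_Icc]

/-- A point of `R` and an interior point of `R` are different points of the torus. -/
lemma chart_injective {c : ℝ} {p : ℤ} {q : ℕ} (hq : 0 < q) (hpq : IsCoprime p (q : ℤ))
    (h : 0 < c - (p : ℝ) / q) {v w : ℝ × ℝ} (hv : v ∈ parallelogram c p q)
    (hw : w ∈ interior (parallelogram c p q)) (hvw : chart c v = chart c w) : v = w := by
  have hr := sqrt_one_add_sq_pos c
  have hβ := beta_pos hq h
  have hq' : (0 : ℝ) < q := by exact_mod_cast hq
  have hq1 : (1 : ℝ) ≤ q := by exact_mod_cast hq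
  rw [← proj_lift, ← proj_lift, proj_eq_iff] at hvw
  obtain ⟨i, j, hij⟩ := hvw
  rw [interior_parallelogram] at hw
  obtain ⟨x, y⟩ := v
  obtain ⟨x', y'⟩ := w
  obtain ⟨⟨hx1, hx2⟩, hy1, hy2⟩ := hv
  obtain ⟨⟨hx1', hx2'⟩, hy1', hy2'⟩ := hw
  simp only [lift_apply, Prod.mk.injEq, length] at *
  obtain ⟨h1, h2⟩ := hij
  have hyi : y = y' + i * √(1 + c ^ 2) := by
    field_simp at h1
    linarith
  have hxj : x = x' + j - c * i := by
    rw [h1] at h2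
    linarith
  have hw0 : width c p q < 1 / q := by
    unfold width
    gcongr
    linarith
  have hw1 : width c p q < 1 := hw0.trans_le (by rw [div_le_one hq']; exact hq1)
  by_cases hi : i = 0
  · subst hi
    have hj1 : (j : ℝ) < 1 := by push_cast at hxj; linarith
    have hj2 : (-1 : ℝ) < j := by push_cast at hxj; linarith
    have h1' : j < 1 := by exact_mod_cast hj1
    have h2' : -1 < j := by exact_mod_cast hj2
    have hj : j = 0 := by omega
    subst hj
    simp at hxj hyi
    simp [hxj, hyi]
  · exfalso
    have hi1 : (i : ℝ) < q := by
      by_contra hcon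
      push Not at hcon
      have := mul_le_mul_of_nonneg_right hcon hr.le
      linarith
    have hi2 : (-q : ℝ) < i := by
      by_contra hcon
      push Not at hcon
      have := mul_le_mul_of_nonneg_right hcon hr.le
      linarith
    -- This is where coprimality enters: `q` cannot divide `i` when `0 < |i| < q`.
    have hne : q * j - p * i ≠ 0 := by
      intro hcon
      have hd : (q : ℤ) ∣ p * i := ⟨j, by linarith⟩
      have hd' : (q : ℤ) ∣ i := hpq.symm.dvd_of_dvd_mul_left hd
      have hlt : |i| < q := by
        rw [abs_lt]
        exact ⟨by exact_mod_cast hi2, by exact_mod_cast hi1⟩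
      exact hi (Int.eq_zero_of_abs_lt_dvd hd' hlt)
    have hone : (1 : ℝ) ≤ |(q : ℝ) * j - p * i| := by exact_mod_cast Int.one_le_abs hne
    have hcβ : c = p / q + beta c p q / q ^ 2 := by
      unfold beta
      field_simp
      ring
    -- The left side is smaller than `1 - β` in absolute value and the last term is at most `β`, so
    -- the nonzero integer `q j - p i` would be smaller than `1`. This is why the width is `(1 - β)
    -- / q`.
    have hci : (q : ℝ) * (x - x') = (q * j - p * i) - beta c p q * (i / q) := by
      rw [hxj]
      have : c * i = (p / q + beta c p q / q ^ 2) * i := by rw [← hcβ]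
      rw [add_sub_assoc, add_sub_cancel_left, this]
      field_simp
      ring
    have hiq : |(i : ℝ) / q| < 1 := by
      rw [abs_div, abs_of_pos hq', div_lt_one hq', abs_lt]
      exact ⟨hi2, hi1⟩
    have hqx : |(q : ℝ) * (x - x')| < 1 - beta c p q := by
      rw [abs_mul, abs_of_pos hq']
      have : |x - x'| < width c p q := by
        rw [abs_lt]
        constructor <;> linarith
      have h3 : 1 - beta c p q = q * width c p q := by
        unfold width
        field_simp
      rw [h3]
      exact mul_lt_mul_of_pos_left this hq'
    have htri : |(q : ℝ) * j - p * i| ≤ |(q : ℝ) * (x - x')| + |beta c p q * (i / q)| := by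
      have : (q : ℝ) * j - p * i = q * (x - x') + beta c p q * (i / q) := by linarith
      rw [this]
      exact abs_add_le _ _
    have hb : |beta c p q * (i / q)| ≤ beta c p q := by
      rw [abs_mul, abs_of_pos hβ]
      nlinarith
    linarith

/-! ### Integrals of a bump along the orbits -/

lemma isOpenQuotientMap_proj : IsOpenQuotientMap proj :=
  QuotientAddGroup.isOpenQuotientMap_mk.prodMap QuotientAddGroup.isOpenQuotientMap_mk

lemma IsBump.continuous {c : ℝ} {p : ℤ} {q : ℕ} {a : ℝ} {g : Torus → ℝ} (hg : IsBump c p q a g) :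
    Continuous g :=
  isOpenQuotientMap_proj.isQuotientMap.continuous_iff.2 hg.smooth.continuous

lemma continuous_comp_flow {c : ℝ} {g : Torus → ℝ} (hg : Continuous g) (z : Torus) :
    Continuous fun s => g (flow c s z) :=
  hg.comp ((continuous_flow c).comp (by fun_prop : Continuous fun s : ℝ => (s, z)))

/-- If a function lives on disjoint intervals of length `q` and has zero integral on each of them,
then its integral between two points outside of these intervals is zero. -/
lemma integral_eq_zero_of_separated {F : ℝ → ℝ} (hF : Continuous F) {q : ℝ}
    {U : Set ℝ} (hsep : ∀ u ∈ U, ∀ v ∈ U, u < v → u + q ≤ v)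
    (hzero : ∀ s, F s ≠ 0 → ∃ u ∈ U, s ∈ Ioo u (u + q))
    (hint : ∀ u ∈ U, ∫ s in u..u + q, F s = 0) (n : ℕ) :
    ∀ S T : ℝ, S ≤ T → T - S ≤ n * q → (∀ u ∈ U, S ∉ Ioo u (u + q)) →
      (∀ u ∈ U, T ∉ Ioo u (u + q)) → ∫ s in S..T, F s = 0 := by
  induction n with
  | zero =>
    intro S T hST hn _ _
    obtain rfl : S = T := by
      simp at hn
      linarith
    simp
  | succ n ih =>
    intro S T hST hn hS hT
    -- Endpoints of the intervals are admissible limits, so cutting out one interval leaves two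
    -- shorter instances of the same claim.
    have hout : ∀ u ∈ U, (∀ v ∈ U, u ∉ Ioo v (v + q)) ∧ ∀ v ∈ U, u + q ∉ Ioo v (v + q) := by
      intro u hu
      refine ⟨fun v hv h => ?_, fun v hv h => ?_⟩
      · linarith [hsep v hv u hu h.1, h.2]
      · rcases lt_trichotomy u v with h' | h' | h'
        · linarith [hsep u hu v hv h', h.1]
        · subst h'
          linarith [h.2]
        · linarith [h.2]
    by_cases hex : ∃ u ∈ U, ∃ s ∈ Ioo S T, s ∈ Ioo u (u + q)
    · obtain ⟨u, hu, s, hs, hsu⟩ := hex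
      have h1 : S ≤ u := by
        by_contra hcon
        exact hS u hu ⟨by linarith, by linarith [hs.1, hsu.2]⟩
      have h2 : u + q ≤ T := by
        by_contra hcon
        exact hT u hu ⟨by linarith [hs.2, hsu.1], by linarith⟩
      push_cast at hn
      have i1 := ih S u h1 (by linarith) hS (hout u hu).1
      have i2 := ih (u + q) T h2 (by linarith) (hout u hu).2 hT
      rw [← intervalIntegral.integral_add_adjacent_intervals (hF.intervalIntegrable S u)
        (hF.intervalIntegrable u T), ← intervalIntegral.integral_add_adjacent_intervals
        (hF.intervalIntegrable u (u + q)) (hF.intervalIntegrable (u + q) T), i1, i2, hint u hu]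
      simp
    · push Not at hex
      rw [intervalIntegral.integral_of_le hST, integral_Ioc_eq_integral_Ioo]
      refine setIntegral_eq_zero_of_forall_eq_zero fun s hs => ?_
      by_contra h
      obtain ⟨u, hu, hsu⟩ := hzero s h
      exact hex u hu s hs hsu

/-- Move both limits to the left until they leave the intervals. Each move has length at most `q`
and costs at most `a q`; between the new limits the integral vanishes. -/
lemma abs_integral_le_of_separated {F : ℝ → ℝ} (hF : Continuous F) {q : ℝ} (hq : 0 < q)
    {U : Set ℝ} (hsep : ∀ u ∈ U, ∀ v ∈ U, u < v → u + q ≤ v)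
    (hzero : ∀ s, F s ≠ 0 → ∃ u ∈ U, s ∈ Ioo u (u + q))
    (hint : ∀ u ∈ U, ∫ s in u..u + q, F s = 0) {a : ℝ} (ha : ∀ s, |F s| ≤ a)
    {T : ℝ} (hT : 0 ≤ T) : |∫ s in 0..T, F s| ≤ 2 * (a * q) := by
  have ha0 : 0 ≤ a := (abs_nonneg _).trans (ha 0)
  -- The last alternative serves only to keep the two moved limits in the right order.
  have key : ∀ x : ℝ, ∃ y ≤ x, x - y ≤ q ∧ (∀ u ∈ U, y ∉ Ioo u (u + q)) ∧
      (y = x ∨ x ∈ Ioo y (y + q) ∧ y ∈ U) := by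
    intro x
    by_cases h : ∃ u ∈ U, x ∈ Ioo u (u + q)
    · obtain ⟨u, hu, hx⟩ := h
      refine ⟨u, hx.1.le, by linarith [hx.2], fun v hv h => ?_, Or.inr ⟨hx, hu⟩⟩
      linarith [hsep v hv u hu h.1, h.2]
    · push Not at h
      exact ⟨x, le_rfl, by linarith, h, Or.inl rfl⟩
  obtain ⟨S', hS1, hS2, hS3, -⟩ := key 0
  obtain ⟨T', hT1, hT2, hT3, hT4⟩ := key T
  have hST : S' ≤ T' := by
    rcases hT4 with rfl | ⟨h, hU⟩
    · linarith
    · by_contra hcon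
      exact hS3 T' hU ⟨by linarith, by linarith [h.2]⟩
  obtain ⟨n, hn⟩ := exists_nat_ge ((T' - S') / q)
  have h0 := integral_eq_zero_of_separated hF hsep hzero hint n S' T' hST
    ((div_le_iff₀ hq).1 hn) hS3 hT3
  have e1 := intervalIntegral.integral_add_adjacent_intervals
    (hF.intervalIntegrable (μ := volume) S' 0) (hF.intervalIntegrable 0 T)
  have e2 := intervalIntegral.integral_add_adjacent_intervals
    (hF.intervalIntegrable (μ := volume) S' T') (hF.intervalIntegrable T' T)
  have b1 := intervalIntegral.norm_integral_le_of_norm_le_const (f := F) (a := S') (b := 0)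
    (fun x _ => ha x)
  have b2 := intervalIntegral.norm_integral_le_of_norm_le_const (f := F) (a := T') (b := T)
    (fun x _ => ha x)
  rw [Real.norm_eq_abs, abs_of_nonneg (by linarith : (0 : ℝ) ≤ 0 - S')] at b1
  rw [Real.norm_eq_abs, abs_of_nonneg (by linarith : (0 : ℝ) ≤ T - T')] at b2
  have b1' := b1.trans (mul_le_mul_of_nonneg_left hS2 ha0)
  have b2' := b2.trans (mul_le_mul_of_nonneg_left hT2 ha0)
  rw [abs_le] at *
  constructor <;> linarith [b1'.1, b1'.2, b2'.1, b2'.2]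

/-- The integral of a bump along any piece of an orbit is bounded independently of its length. -/
lemma IsBump.abs_integral_flow_le {c : ℝ} {p : ℤ} {q : ℕ} {a : ℝ} {g : Torus → ℝ}
    (hg : IsBump c p q a g) (hq : 0 < q) (hpq : IsCoprime p (q : ℤ))
    (h : 0 < c - (p : ℝ) / q) (z : Torus) {T : ℝ} (hT : 0 ≤ T) :
    |∫ s in 0..T, g (flow c s z)| ≤ 2 * (a * q) := by
  have hr := sqrt_one_add_sq_pos c
  have hq' : (0 : ℝ) < q := by exact_mod_cast hq
  -- The times at which the orbit enters `R`. Two of them closer than `q` would identify a point of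
  -- the entry side with an interior point of `R`.
  let U : Set ℝ := {u | ∃ x ∈ Ioo 0 (width c p q), flow c u z = chart c (x, 0)}
  have hU : ∀ {u x : ℝ}, flow c u z = chart c (x, 0) → ∀ s,
      flow c s z = chart c (x, (s - u) * √(1 + c ^ 2)) := by
    intro u x hu s
    rw [show s = u + (s - u) by ring, ← flow_flow, hu, flow_chart]
    congr 2
    ring
  refine abs_integral_le_of_separated (U := U) (continuous_comp_flow hg.continuous z) hq'
    ?_ ?_ ?_ (fun s => hg.abs_le _) hT
  · rintro u ⟨x, hx, hu⟩ v ⟨x', hx', hv⟩ huv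
    by_contra hcon
    push Not at hcon
    have e := hU hu v
    rw [hv] at e
    have := chart_injective (p := p) hq hpq h (v := (x', 0)) (w := (x, (v - u) * √(1 + c ^ 2)))
      ⟨⟨hx'.1.le, hx'.2.le⟩, le_rfl, by unfold length; positivity⟩ ?_ e
    · have h2 := (Prod.ext_iff.1 this).2
      have : 0 < (v - u) * √(1 + c ^ 2) := mul_pos (by linarith) hr
      exact this.ne h2
    · rw [interior_parallelogram]
      refine ⟨hx, mul_pos (by linarith) hr, ?_⟩
      exact mul_lt_mul_of_pos_right (by linarith) hr
  · intro s hs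
    have hmem : flow c s z ∈ chart c '' interior (parallelogram c p q) := by
      by_contra hcon
      exact hs (hg.eq_zero _ hcon)
    rw [interior_parallelogram] at hmem
    obtain ⟨⟨x, y⟩, ⟨hx, hy1, hy2⟩, e⟩ := hmem
    simp only [length] at hy1 hy2
    refine ⟨s - y / √(1 + c ^ 2), ⟨x, hx, ?_⟩, ?_, ?_⟩
    · rw [sub_eq_add_neg, ← flow_flow, ← e, flow_chart]
      congr 2
      field_simp
      ring
    · have : 0 < y / √(1 + c ^ 2) := by positivity
      linarith
    · have : y / √(1 + c ^ 2) < q := (div_lt_iff₀ hr).2 hy2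
      linarith
  · rintro u ⟨x, hx, hu⟩
    simp_rw [hU hu]
    rw [intervalIntegral.integral_comp_sub_right
      (fun s => g (chart c (x, s * √(1 + c ^ 2)))),
      intervalIntegral.integral_comp_mul_right (fun y => g (chart c (x, y))) hr.ne']
    have := hg.fibre x ⟨hx.1.le, hx.2.le⟩
    rw [length] at this
    simp [this]

/-! ### Points whose orbit stays on the plateau for a long time -/

lemma width_le {c : ℝ} {p : ℤ} {q : ℕ} (hq : 0 < q) (h : 0 < c - (p : ℝ) / q) :
    width c p q ≤ 1 / q := by
  unfold width
  gcongr
  linarith [beta_pos hq h]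

lemma quarter_zero (c : ℝ) (p : ℤ) (q : ℕ) :
    quarter c p q 0 = Icc 0 (width c p q) ×ˢ Icc 0 (length c q / 4) := by
  simp [quarter]

/-- Tonelli and the invariance of the volume under the flow. -/
lemma lintegral_occupation_time (c : ℝ) {P : Set Torus} (hP : MeasurableSet P) (t : ℝ) :
    ∫⁻ z : Torus, volume.restrict (Ioc 0 t) ((fun s => flow c s z) ⁻¹' P) =
      ENNReal.ofReal t * volume P := by
  have hm : Measurable fun w : Torus × ℝ => flow c w.2 w.1 :=
    ((continuous_flow c).comp continuous_swap).measurable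
  have h1 : ∀ z : Torus, volume.restrict (Ioc 0 t) ((fun s => flow c s z) ⁻¹' P) =
      ∫⁻ s in Ioc 0 t, P.indicator 1 (flow c s z) := by
    intro z
    have hz : MeasurableSet ((fun s => flow c s z) ⁻¹' P) :=
      hP.preimage (hm.comp measurable_prodMk_left)
    rw [← lintegral_indicator_one hz]
    rfl
  simp_rw [h1]
  rw [lintegral_lintegral_swap (f := fun z s => P.indicator 1 (flow c s z))
    (((measurable_one.indicator hP).comp hm).aemeasurable)]
  have h2 : ∀ s, ∫⁻ z : Torus, P.indicator 1 (flow c s z) = volume P := by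
    intro s
    rw [(measurePreserving_flow c s).lintegral_comp (measurable_one.indicator hP),
      lintegral_indicator_one hP]
  simp_rw [h2]
  simp [mul_comm]

/-- Integrate over `z` the time spent in the plateau during `[0, t]`; the total is `t` times its
area. That time is at most `t` on the good set `E` and on two thin strips, at most `t / 2` at the
other points of the first quarter (whose area is at most `1/4`), and zero elsewhere. Divide by `t`.
-/
lemma IsBump.volume_plateau_le {c : ℝ} {p : ℤ} {q : ℕ} {a : ℝ} {g : Torus → ℝ}
    (hg : IsBump c p q a g) (hq : 0 < q) (h : 0 < c - (p : ℝ) / q) (ha : 0 ≤ a)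
    {K : Set (ℝ × ℝ)} (hK : IsCompact K) (hKQ : K ⊆ quarter c p q 0)
    (hga : ∀ w ∈ K, g (chart c w) = a) {t : ℝ} (ht : 0 < t) :
    volume (chart c '' K) ≤ volume {z | a * (t / 2) ≤ ∫ s in 0..t, g (flow c s z)} +
      ENNReal.ofReal (2 * (t / q)) + ENNReal.ofReal (1 / 8) := by
  have hr := sqrt_one_add_sq_pos c
  have hq' : (0 : ℝ) < q := by exact_mod_cast hq
  have hwq := width_le hq h
  have hgc := hg.continuous
  set r := √(1 + c ^ 2) with hrdef
  set w := width c p q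
  set P := chart c '' K
  have hP : MeasurableSet P := (hK.image (continuous_chart c)).measurableSet
  set E := {z | a * (t / 2) ≤ ∫ s in 0..t, g (flow c s z)} with hEdef
  have hE : MeasurableSet E := by
    refine (isClosed_le continuous_const ?_).measurableSet
    exact intervalIntegral.continuous_parametric_intervalIntegral_of_continuous'
      (f := fun z s => g (flow c s z))
      (hgc.comp ((continuous_flow c).comp continuous_swap)) 0 t
  -- From `D` the orbit stays in the first quarter up to time `t`; `B₁` holds the points about to
  -- enter that quarter and `B₂` those about to leave it.
  set D := chart c '' (Icc 0 w ×ˢ Icc 0 (length c q / 4 - t * r))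
  set B₁ := chart c '' (Icc 0 w ×ˢ Icc (-(t * r)) 0)
  set B₂ := chart c '' (Icc 0 w ×ˢ Icc (length c q / 4 - t * r) (length c q / 4))
  have hD : MeasurableSet D := (isCompact_chart_image ..).measurableSet
  have hB₁ : MeasurableSet B₁ := (isCompact_chart_image ..).measurableSet
  have hB₂ : MeasurableSet B₂ := (isCompact_chart_image ..).measurableSet
  have hrect : ∀ y : ℝ, ENNReal.ofReal w * ENNReal.ofReal y ≤ ENNReal.ofReal (y / q) := by
    intro y
    rcases le_total y 0 with hy | hy
    · simp [ENNReal.ofReal_of_nonpos hy]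
    · rw [mul_comm, ← ENNReal.ofReal_mul hy]
      refine ENNReal.ofReal_le_ofReal ?_
      rw [div_eq_mul_one_div]
      gcongr
  have hDv : volume D ≤ ENNReal.ofReal (1 / 4) := by
    refine (volume_chart_rect_le c).trans ((hrect _).trans (ENNReal.ofReal_le_ofReal ?_))
    rw [div_le_iff₀ hq', div_le_iff₀ hr, length]
    nlinarith [mul_pos ht hr]
  have hB₁v : volume B₁ ≤ ENNReal.ofReal (t / q) := by
    refine (volume_chart_rect_le c).trans ((hrect _).trans (ENNReal.ofReal_le_ofReal ?_))
    rw [← hrdef]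
    apply le_of_eq
    field_simp
    ring
  have hB₂v : volume B₂ ≤ ENNReal.ofReal (t / q) := by
    refine (volume_chart_rect_le c).trans ((hrect _).trans (ENNReal.ofReal_le_ofReal ?_))
    rw [← hrdef]
    apply le_of_eq
    field_simp
    ring
  let u : Torus → ENNReal := fun z => volume.restrict (Ioc 0 t) ((fun s => flow c s z) ⁻¹' P)
  have hut : ∀ z, u z ≤ ENNReal.ofReal t := by
    intro z
    refine (measure_mono (subset_univ _)).trans ?_
    simp
  have hpt : ∀ z, u z ≤ E.indicator (fun _ => ENNReal.ofReal t) z +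
      B₁.indicator (fun _ => ENNReal.ofReal t) z + B₂.indicator (fun _ => ENNReal.ofReal t) z +
      D.indicator (fun _ => ENNReal.ofReal (t / 2)) z := by
    intro z
    by_cases hzE : z ∈ E
    · rw [indicator_of_mem hzE]
      exact (hut z).trans (by rw [add_assoc, add_assoc]; exact le_self_add)
    by_cases hz₁ : z ∈ B₁
    · rw [indicator_of_mem hz₁, add_assoc, add_assoc, add_left_comm]
      exact (hut z).trans le_self_add
    by_cases hz₂ : z ∈ B₂
    · rw [indicator_of_mem hz₂, add_assoc, add_left_comm]
      exact (hut z).trans le_self_add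
    by_cases hzD : z ∈ D
    · rw [indicator_of_mem hzD, add_comm]
      refine le_trans ?_ le_self_add
      by_contra hcon
      push Not at hcon
      -- More than `t / 2` is spent on the plateau and `g ≥ 0` along the whole piece of orbit, so
      -- the integral is at least `a t / 2`.
      apply hzE
      have hpm : MeasurableSet ((fun s => flow c s z) ⁻¹' P) :=
        hP.preimage
          ((continuous_flow c).comp (by fun_prop : Continuous fun s : ℝ => (s, z))).measurable
      have hv : t / 2 ≤ (volume.restrict (Ioc 0 t)).real ((fun s => flow c s z) ⁻¹' P) := by
        rw [measureReal_def]
        exact (ENNReal.ofReal_le_iff_le_toReal (measure_ne_top _ _)).1 hcon.le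
      rw [hEdef, mem_ofPred_eq, intervalIntegral.integral_of_le ht.le]
      calc a * (t / 2) ≤ a * (volume.restrict (Ioc 0 t)).real ((fun s => flow c s z) ⁻¹' P) := by
            gcongr
        _ = ∫ s in Ioc 0 t, ((fun s => flow c s z) ⁻¹' P).indicator (fun _ => a) s := by
            rw [integral_indicator_const _ hpm, smul_eq_mul, mul_comm]
        _ ≤ ∫ s in Ioc 0 t, g (flow c s z) := by
            refine setIntegral_mono_on ((integrable_const a).indicator hpm)
              ((continuous_comp_flow hgc z).integrableOn_Ioc) measurableSet_Ioc fun s hs => ?_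
            by_cases hsP : flow c s z ∈ P
            · rw [indicator_of_mem (by exact hsP)]
              obtain ⟨v, hv, hv'⟩ := hsP
              rw [← hv', hga v hv]
            · rw [indicator_of_notMem (by exact hsP)]
              obtain ⟨⟨x, y⟩, ⟨hx, hy⟩, rfl⟩ := hzD
              rw [flow_chart]
              refine hg.first _ ?_
              rw [quarter_zero]
              simp only [mem_Icc] at hy
              have := mul_le_mul_of_nonneg_right hs.2 hr.le
              have := mul_nonneg hs.1.le hr.le
              exact ⟨hx, by simp only [← hrdef]; linarith, by simp only [← hrdef]; linarith⟩
    · have h0 : u z = 0 := by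
        simp only [u]
        rw [Measure.restrict_apply' measurableSet_Ioc]
        have : (fun s => flow c s z) ⁻¹' P ∩ Ioc 0 t = ∅ := by
          refine eq_empty_of_forall_notMem ?_
          rintro s ⟨⟨⟨x, y⟩, hv, hs⟩, hs1, hs2⟩
          have hv := hKQ hv
          rw [quarter_zero] at hv
          obtain ⟨hx, hy1, hy2⟩ := hv
          simp only at hy1 hy2
          have hz : z = chart c (x, y - s * r) := by
            rw [← flow_zero c z, ← add_neg_cancel s, ← flow_flow]
            have hs' : flow c s z = chart c (x, y) := hs.symm
            rw [hs', flow_chart]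
            congr 2
            ring
          have k1 := mul_le_mul_of_nonneg_right hs2 hr.le
          have k2 := mul_pos hs1 hr
          rcases le_or_gt (y - s * r) 0 with hy | hy
          · exact hz₁ ⟨(x, y - s * r), ⟨hx, by simp only; linarith, hy⟩, hz.symm⟩
          · rcases le_or_gt (y - s * r) (length c q / 4 - t * r) with hy' | hy'
            · exact hzD ⟨(x, y - s * r), ⟨hx, hy.le, hy'⟩, hz.symm⟩
            · exact hz₂ ⟨(x, y - s * r), ⟨hx, hy'.le, by simp only; linarith⟩, hz.symm⟩
        rw [this, measure_empty]
      rw [h0]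
      exact zero_le
  have hint := lintegral_mono hpt (μ := volume)
  rw [lintegral_occupation_time c hP t, lintegral_add_right _ (measurable_const.indicator hD),
    lintegral_add_right _ (measurable_const.indicator hB₂),
    lintegral_add_right _ (measurable_const.indicator hB₁),
    lintegral_indicator_const hE, lintegral_indicator_const hB₁, lintegral_indicator_const hB₂,
    lintegral_indicator_const hD] at hint
  have ht0 : ENNReal.ofReal t ≠ 0 := by simpa using ht
  rw [← ENNReal.mul_le_mul_iff_right ht0 ENNReal.ofReal_ne_top]
  refine hint.trans ?_
  have e1 : ENNReal.ofReal (2 * (t / q)) = ENNReal.ofReal (t / q) + ENNReal.ofReal (t / q) := by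
    rw [two_mul, ENNReal.ofReal_add (by positivity) (by positivity)]
  have e2 : ENNReal.ofReal t * ENNReal.ofReal (1 / 8) =
      ENNReal.ofReal (t / 2) * ENNReal.ofReal (1 / 4) := by
    rw [← ENNReal.ofReal_mul (by positivity), ← ENNReal.ofReal_mul (by positivity)]
    congr 1
    ring
  rw [mul_add, mul_add, e1, mul_add, e2, ← add_assoc]
  gcongr

/-! ### The time averages of the sum -/

/-- The limsup set is a decreasing intersection of tail unions, each of measure at least `ε`;
finiteness of `μ` gives continuity from above. -/
lemma le_measure_setOf_frequently {α : Type*} [MeasurableSpace α] {μ : Measure α}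
    [IsFiniteMeasure μ] {E : ℕ → Set α} (hE : ∀ n, MeasurableSet (E n)) {ε : ENNReal}
    (h : ∀ᶠ n in atTop, ε ≤ μ (E n)) : ε ≤ μ {x | ∃ᶠ n in atTop, x ∈ E n} := by
  have e : {x | ∃ᶠ n in atTop, x ∈ E n} = ⋂ N, ⋃ n ≥ N, E n := by
    ext x
    simp [frequently_atTop]
  have hanti : Antitone fun N => ⋃ n ≥ N, E n := fun M N hMN =>
    biUnion_mono (fun n hn => le_trans hMN hn) fun _ _ => le_rfl
  rw [e]
  refine ge_of_tendsto (tendsto_measure_iInter_atTop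
    (fun N => (MeasurableSet.biUnion (to_countable _) fun n _ => hE n).nullMeasurableSet)
    hanti ⟨0, measure_ne_top _ _⟩) ?_
  filter_upwards [h] with n hn
  exact hn.trans (measure_mono (subset_biUnion_of_mem (u := E) (le_refl n)))

lemma continuous_integral_flow {c : ℝ} {g : Torus → ℝ} (hg : Continuous g) (t : ℝ) :
    Continuous fun z => ∫ s in 0..t, g (flow c s z) :=
  intervalIntegral.continuous_parametric_intervalIntegral_of_continuous'
    (f := fun z s => g (flow c s z)) (hg.comp ((continuous_flow c).comp continuous_swap)) 0 t

lemma continuous_timeAverage {c : ℝ} {g : Torus → ℝ} (hg : Continuous g) (t : ℝ) :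
    Continuous (timeAverage c g t) :=
  continuous_const.mul (continuous_integral_flow hg t)

/-- The time windows `[σ, σ + t]` and `[0, t]` differ by two intervals of length `|σ|`. -/
lemma abs_integral_flow_flow_sub_le {c : ℝ} {g : Torus → ℝ} (hg : Continuous g) {C : ℝ}
    (hC : ∀ z, |g z| ≤ C) (σ t : ℝ) (z : Torus) :
    |(∫ s in 0..t, g (flow c s (flow c σ z))) - ∫ s in 0..t, g (flow c s z)| ≤
      2 * (C * |σ|) := by
  have hF := continuous_comp_flow (c := c) hg z
  simp_rw [flow_flow]
  rw [intervalIntegral.integral_comp_add_left (fun s => g (flow c s z)) σ, add_zero]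
  have e1 := intervalIntegral.integral_add_adjacent_intervals
    (hF.intervalIntegrable (μ := volume) 0 σ) (hF.intervalIntegrable σ (σ + t))
  have e2 := intervalIntegral.integral_add_adjacent_intervals
    (hF.intervalIntegrable (μ := volume) 0 t) (hF.intervalIntegrable t (σ + t))
  have b1 := intervalIntegral.norm_integral_le_of_norm_le_const (f := fun s => g (flow c s z))
    (a := 0) (b := σ) (fun x _ => hC _)
  have b2 := intervalIntegral.norm_integral_le_of_norm_le_const (f := fun s => g (flow c s z))
    (a := t) (b := σ + t) (fun x _ => hC _)
  rw [Real.norm_eq_abs, sub_zero] at b1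
  rw [Real.norm_eq_abs, add_sub_cancel_right] at b2
  rw [abs_le] at *
  constructor <;> linarith [b1.1, b1.2, b2.1, b2.2]

section Construction

variable {c : ℝ} {p : ℕ → ℤ} {q : ℕ → ℕ} {φ : ℝ → ℝ} {a δ : ℕ → ℝ} {f : ℕ → Torus → ℝ}

lemma IsConstruction.continuous_tsum (h : IsConstruction c p q φ a δ f) :
    Continuous fun z => ∑' n, f n z :=
  _root_.continuous_tsum (fun n => (h.bump n).continuous) h.amp_summable
    fun n z => (h.bump n).abs_le z

lemma IsConstruction.summable (h : IsConstruction c p q φ a δ f) (z : Torus) :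
    Summable fun n => f n z :=
  h.amp_summable.of_norm_bounded fun n => (h.bump n).abs_le z

lemma IsConstruction.abs_tsum_le (h : IsConstruction c p q φ a δ f) (z : Torus) :
    |∑' n, f n z| ≤ ∑' n, a n :=
  tsum_of_norm_bounded (f := fun n => f n z) h.amp_summable.hasSum fun n => (h.bump n).abs_le z

lemma IsConstruction.abs_tail_le (h : IsConstruction c p q φ a δ f) (n : ℕ) (z : Torus) :
    |(∑' m, f m z) - ∑ m ∈ Finset.range (n + 1), f m z| ≤ a n * tailRatio a n := by
  have e : (∑' m, f m z) - ∑ m ∈ Finset.range (n + 1), f m z = ∑' m, f (m + (n + 1)) z := by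
    rw [← (h.summable z).sum_add_tsum_nat_add (n + 1), add_sub_cancel_left]
  have hs : Summable fun m => a (m + (n + 1)) := (summable_nat_add_iff (n + 1)).2 h.amp_summable
  have e' : a n * tailRatio a n = ∑' m, a (m + (n + 1)) := by
    rw [tailRatio, mul_div_cancel₀ _ (h.amp_pos n).ne']
    exact tsum_congr fun m => by rw [add_comm]
  rw [e, e']
  exact tsum_of_norm_bounded (f := fun m => f (m + (n + 1)) z) hs.hasSum
    fun m => (h.bump _).abs_le z

lemma IsConstruction.time_pos (h : IsConstruction c p q φ a δ f) (hq : ∀ n, 0 < q n) (n : ℕ) :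
    0 < time c q δ n :=
  mul_pos (mul_pos (h.delta_pos n) (by exact_mod_cast hq n)) (sqrt_one_add_sq_pos c)

/-- The two error terms come from the bumps before `n`, with each `a m` replaced by the full sum,
and from those after `n`. -/
lemma IsConstruction.le_integral_tsum (h : IsConstruction c p q φ a δ f)
    (hpq : IsApproximation c p q) (n : ℕ) {t : ℝ} (ht : 0 ≤ t) (z : Torus) :
    (∫ s in 0..t, f n (flow c s z)) - 2 * (∑' m, a m) * (∑ m ∈ Finset.range n, (q m : ℝ)) -
      t * (a n * tailRatio a n) ≤ ∫ s in 0..t, ∑' m, f m (flow c s z) := by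
  have hc : ∀ m, Continuous fun s => f m (flow c s z) := fun m =>
    continuous_comp_flow (h.bump m).continuous z
  have hcs : Continuous fun s => ∑' m, f m (flow c s z) :=
    continuous_comp_flow (g := fun z => ∑' m, f m z) h.continuous_tsum z
  have hsum : Continuous fun s => ∑ m ∈ Finset.range (n + 1), f m (flow c s z) :=
    continuous_finsetSum _ fun m _ => hc m
  have b := intervalIntegral.norm_integral_le_of_norm_le_const
    (f := fun s => (∑' m, f m (flow c s z)) - ∑ m ∈ Finset.range (n + 1), f m (flow c s z))
    (a := 0) (b := t) (fun s _ => h.abs_tail_le n _)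
  rw [intervalIntegral.integral_sub (hcs.intervalIntegrable _ _) (hsum.intervalIntegrable _ _),
    intervalIntegral.integral_finsetSum (fun m _ => (hc m).intervalIntegrable _ _),
    Finset.sum_range_succ, sub_zero, abs_of_nonneg ht, Real.norm_eq_abs] at b
  have hold : |∑ m ∈ Finset.range n, ∫ s in 0..t, f m (flow c s z)| ≤
      2 * (∑' m, a m) * (∑ m ∈ Finset.range n, (q m : ℝ)) := by
    rw [Finset.mul_sum]
    refine (Finset.abs_sum_le_sum_abs _ _).trans (Finset.sum_le_sum fun m _ => ?_)
    refine ((h.bump m).abs_integral_flow_le (hpq.pos m) (hpq.coprime m) (hpq.lt m) z ht).trans ?_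
    have := h.amp_summable.le_tsum m fun k _ => (h.amp_pos k).le
    rw [mul_assoc]
    gcongr
  have b1 := (abs_le.1 b).1
  have b2 := (abs_le.1 hold).1
  linarith

/-- For `n ≥ 1` the numerator in the growth condition is at least `q 0 ≥ 1`, so the denominator must
tend to infinity. -/
lemma IsConstruction.tendsto_denom (h : IsConstruction c p q φ a δ f) (hq : ∀ n, 0 < q n) :
    Tendsto (fun n => q n * a n * δ n) atTop atTop := by
  have hpos : ∀ n, 0 < q n * a n * δ n := fun n =>
    mul_pos (mul_pos (by exact_mod_cast hq n) (h.amp_pos n)) (h.delta_pos n)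
  have h0 : Tendsto (fun n => (q n * a n * δ n)⁻¹) atTop (𝓝[>] 0) := by
    refine tendsto_nhdsWithin_iff.2 ⟨?_, Eventually.of_forall fun n => inv_pos.2 (hpos n)⟩
    refine squeeze_zero' (Eventually.of_forall fun n => (inv_pos.2 (hpos n)).le) ?_ h.growth
    filter_upwards [eventually_ge_atTop 1] with n hn
    rw [inv_eq_one_div]
    refine div_le_div_of_nonneg_right ?_ (hpos n).le
    have h1 : (1 : ℝ) ≤ q 0 := by exact_mod_cast hq 0
    exact h1.trans (Finset.single_le_sum (f := fun m => (q m : ℝ))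
      (fun _ _ => by positivity) (Finset.mem_range.2 hn))
  exact h0.inv_tendsto_nhdsGT_zero.congr fun n => inv_inv _

lemma time_mul (c : ℝ) (q : ℕ → ℕ) (a δ : ℕ → ℝ) (n : ℕ) :
    time c q δ n * a n = √(1 + c ^ 2) * (q n * a n * δ n) := by
  unfold time
  ring

lemma IsConstruction.tendsto_time_mul (h : IsConstruction c p q φ a δ f) (hq : ∀ n, 0 < q n) :
    Tendsto (fun n => time c q δ n * a n) atTop atTop := by
  simp_rw [time_mul]
  exact (h.tendsto_denom hq).const_mul_atTop (sqrt_one_add_sq_pos c)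

lemma IsConstruction.tendsto_time (h : IsConstruction c p q φ a δ f) (hq : ∀ n, 0 < q n) :
    Tendsto (time c q δ) atTop atTop := by
  refine tendsto_atTop_mono' _ ?_ (h.tendsto_time_mul hq)
  filter_upwards [h.amp_summable.tendsto_atTop_zero.eventually (gt_mem_nhds one_pos)] with n hn
  exact mul_le_of_le_one_right (h.time_pos hq n).le hn.le

/-- The points at which the averages of the `n`-th bump up to the time `t_n` are at least half of
its amplitude. -/
def favourable (c : ℝ) (q : ℕ → ℕ) (a δ : ℕ → ℝ) (f : ℕ → Torus → ℝ) (n : ℕ) : Set Torus :=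
  {z | a n * (time c q δ n / 2) ≤ ∫ s in 0..time c q δ n, f n (flow c s z)}

lemma IsConstruction.measurableSet_favourable (h : IsConstruction c p q φ a δ f) (n : ℕ) :
    MeasurableSet (favourable c q a δ f n) :=
  (isClosed_le continuous_const
    (continuous_integral_flow (h.bump n).continuous _)).measurableSet

lemma IsConstruction.eventually_le_volume_favourable (h : IsConstruction c p q φ a δ f)
    (hpq : IsApproximation c p q) :
    ∀ᶠ n in atTop, ENNReal.ofReal (1 / 32) ≤ volume (favourable c q a δ f n) := by
  obtain ⟨K, hK, hlim⟩ := h.plateau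
  have hδ : Tendsto (fun n => 2 * (δ n * √(1 + c ^ 2))) atTop (𝓝 0) := by
    simpa using (h.delta_tendsto.mul_const (√(1 + c ^ 2))).const_mul 2
  -- The constants balance as `7/32 - 1/16 - 1/8 = 1/32`: plateau, thin strips, remainder of the
  -- quarter.
  filter_upwards [hlim.eventually (lt_mem_nhds (show (7 / 32 : ℝ) < 1 / 4 by norm_num)),
    hδ.eventually (gt_mem_nhds (show (0 : ℝ) < 1 / 16 by norm_num))] with n h1 h2
  have hq' : (0 : ℝ) < q n := by exact_mod_cast hpq.pos n
  have key := (h.bump n).volume_plateau_le (hpq.pos n) (hpq.lt n) (h.amp_pos n).le (hK n).1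
    ((hK n).2.1.trans interior_subset) (hK n).2.2 (h.time_pos hpq.pos n)
  have e : 2 * (time c q δ n / q n) = 2 * (δ n * √(1 + c ^ 2)) := by
    unfold time
    field_simp
  rw [e] at key
  have k1 : ENNReal.ofReal (7 / 32) ≤ volume (chart c '' K n) :=
    (ENNReal.ofReal_le_iff_le_toReal (measure_ne_top _ _)).2 h1.le
  have k2 : volume (favourable c q a δ f n) + ENNReal.ofReal (2 * (δ n * √(1 + c ^ 2))) +
      ENNReal.ofReal (1 / 8) ≤ volume (favourable c q a δ f n) + ENNReal.ofReal (3 / 16) := by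
    rw [add_assoc, ← ENNReal.ofReal_add
      (mul_nonneg two_pos.le (mul_nonneg (h.delta_pos n).le (sqrt_one_add_sq_pos c).le))
      (by norm_num)]
    gcongr
    linarith
  have k3 := k1.trans (key.trans k2)
  rw [show (7 / 32 : ℝ) = 1 / 32 + 3 / 16 by norm_num,
    ENNReal.ofReal_add (by norm_num) (by norm_num)] at k3
  exact (ENNReal.add_le_add_iff_right ENNReal.ofReal_ne_top).1 k3

lemma IsConstruction.eventually_le_timeAverage (h : IsConstruction c p q φ a δ f)
    (hpq : IsApproximation c p q) :
    ∀ᶠ n in atTop, ∀ z ∈ favourable c q a δ f n,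
      a n / 4 ≤ timeAverage c (fun w => ∑' m, f m w) (time c q δ n) z := by
  have hgr : Tendsto (fun n => 2 * (∑' m, a m) / √(1 + c ^ 2) *
      ((∑ m ∈ Finset.range n, (q m : ℝ)) / (q n * a n * δ n))) atTop (𝓝 0) := by
    simpa using h.growth.const_mul (2 * (∑' m, a m) / √(1 + c ^ 2))
  -- Earlier and later bumps each take at most `1/8` from the `1/2` supplied by `f n`, which leaves
  -- `1/4`.
  filter_upwards [hgr.eventually (gt_mem_nhds (show (0 : ℝ) < 1 / 8 by norm_num)),
    h.amp_tail.eventually (gt_mem_nhds (show (0 : ℝ) < 1 / 8 by norm_num))] with n h1 h2 z hz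
  have ht := h.time_pos hpq.pos n
  have ha := h.amp_pos n
  have hta := mul_pos ht ha
  have hr := sqrt_one_add_sq_pos c
  have key := h.le_integral_tsum hpq n ht.le z
  have hz' : a n * (time c q δ n / 2) ≤ ∫ s in 0..time c q δ n, f n (flow c s z) := hz
  have e1 : 2 * (∑' m, a m) * (∑ m ∈ Finset.range n, (q m : ℝ)) ≤
      1 / 8 * (time c q δ n * a n) := by
    rw [← div_le_iff₀ hta, time_mul]
    refine le_trans (le_of_eq ?_) h1.le
    rw [div_mul_div_comm]
  have e2 : time c q δ n * (a n * tailRatio a n) ≤ 1 / 8 * (time c q δ n * a n) := by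
    rw [← mul_assoc, mul_comm]
    exact mul_le_mul_of_nonneg_right h2.le hta.le
  rw [timeAverage, one_div, inv_mul_eq_div, le_div_iff₀ ht]
  linarith

/-- The points at which the averages up to the times `t_n` are infinitely often at least a constant
multiple of the amplitudes. -/
def divergent (c : ℝ) (q : ℕ → ℕ) (a δ : ℕ → ℝ) (f : ℕ → Torus → ℝ) : Set Torus :=
  ⋃ j : ℕ, {z | ∃ᶠ n in atTop,
    z ∈ {z | a n / (j + 1) ≤ timeAverage c (fun w => ∑' m, f m w) (time c q δ n) z}}

lemma IsConstruction.measurableSet_divergent (h : IsConstruction c p q φ a δ f) :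
    MeasurableSet (divergent c q a δ f) := by
  refine MeasurableSet.iUnion fun j => ?_
  have hm : ∀ n, MeasurableSet
      {z | a n / (j + 1) ≤ timeAverage c (fun w => ∑' m, f m w) (time c q δ n) z} := fun n =>
    (isClosed_le continuous_const (continuous_timeAverage h.continuous_tsum _)).measurableSet
  convert MeasurableSet.measurableSet_limsup hm using 1
  ext z
  rw [mem_limsup_iff_frequently_mem]
  rfl

/-- A shift by `σ` costs a bounded amount in the integral. As `t_n a_n → ∞`, halving the constant
absorbs it: `1 / (j + 1)` becomes `1 / (2 (j + 1))`, which has index `2 j + 1`. -/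
lemma IsConstruction.flow_mem_divergent (h : IsConstruction c p q φ a δ f)
    (hq : ∀ n, 0 < q n) (σ : ℝ) (z : Torus) (hz : z ∈ divergent c q a δ f) :
    flow c σ z ∈ divergent c q a δ f := by
  obtain ⟨j, hj⟩ := mem_iUnion.1 hz
  refine mem_iUnion.2 ⟨2 * j + 1, ?_⟩
  have hev := (h.tendsto_time_mul hq).eventually_ge_atTop
    (2 * ((∑' n, a n) * |σ|) * (2 * (j + 1)))
  refine (Frequently.and_eventually hj hev).mono ?_
  rintro n ⟨h1, h2⟩
  have ht := h.time_pos hq n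
  have h1' : a n / (j + 1) ≤ timeAverage c (fun w => ∑' m, f m w) (time c q δ n) z := h1
  change a n / (((2 * j + 1 : ℕ) : ℝ) + 1) ≤
    timeAverage c (fun w => ∑' m, f m w) (time c q δ n) (flow c σ z)
  have hb := (abs_le.1 (abs_integral_flow_flow_sub_le (c := c) h.continuous_tsum h.abs_tsum_le σ
    (time c q δ n) z)).1
  rw [timeAverage, one_div, inv_mul_eq_div, le_div_iff₀ ht] at h1' ⊢
  have hj0 : (0 : ℝ) < j + 1 := by positivity
  have e1 : 2 * ((∑' n, a n) * |σ|) ≤ a n / (2 * (j + 1)) * time c q δ n := by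
    rw [div_mul_eq_mul_div, le_div_iff₀ (by positivity)]
    linarith
  have e2 : a n / (j + 1) * time c q δ n = 2 * (a n / (2 * (j + 1)) * time c q δ n) := by
    field_simp
  have e3 : ((2 * j + 1 : ℕ) : ℝ) + 1 = 2 * (j + 1) := by
    push_cast
    ring
  rw [e3]
  linarith

lemma IsConstruction.ae_mem_divergent (h : IsConstruction c p q φ a δ f) (hc : Irrational c)
    (hpq : IsApproximation c p q) : ∀ᵐ z : Torus, z ∈ divergent c q a δ f := by
  refine ae_mem_of_flow_invariant hc h.measurableSet_divergent (h.flow_mem_divergent hpq.pos) ?_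
  have h1 := le_measure_setOf_frequently (μ := (volume : Measure Torus))
    h.measurableSet_favourable (h.eventually_le_volume_favourable hpq)
  have h2 : {z | ∃ᶠ n in atTop, z ∈ favourable c q a δ f n} ⊆ divergent c q a δ f := by
    intro z hz
    refine mem_iUnion.2 ⟨3, ?_⟩
    refine (Frequently.and_eventually hz (h.eventually_le_timeAverage hpq)).mono ?_
    rintro n ⟨hn, hn'⟩
    have := hn' z hn
    change a n / (((3 : ℕ) : ℝ) + 1) ≤ _
    norm_num
    exact this
  have h3 := h1.trans (measure_mono h2)
  intro h0
  rw [h0] at h3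
  norm_num at h3

lemma IsConstruction.tendsto_amp_div (h : IsConstruction c p q φ a δ f) (hq : ∀ n, 0 < q n)
    (hφ : Tendsto φ atTop (𝓝[>] 0)) :
    Tendsto (fun n => a n / φ (time c q δ n)) atTop atTop := by
  refine tendsto_atTop_mono' _ ?_ h.rate
  have hpos := (h.tendsto_time hq).eventually (hφ.eventually self_mem_nhdsWithin)
  filter_upwards [hpos, h.amp_tail.eventually (gt_mem_nhds one_pos)] with n h1 h2
  have h1' : 0 < φ (time c q δ n) := h1
  refine div_le_div_of_nonneg_right ?_ h1'.le
  exact mul_le_of_le_one_right (h.amp_pos n).le h2.le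

lemma IsConstruction.limsup_eq_top (h : IsConstruction c p q φ a δ f) (hq : ∀ n, 0 < q n)
    (hφ : Tendsto φ atTop (𝓝[>] 0)) {z : Torus} (hz : z ∈ divergent c q a δ f) :
    limsup (fun t : ℝ =>
      ((1 / φ t * |timeAverage c (fun w => ∑' n, f n w) t z| : ℝ) : EReal)) atTop = ⊤ := by
  rw [EReal.eq_top_iff_forall_lt]
  intro M
  obtain ⟨j, hj⟩ := mem_iUnion.1 hz
  have hpos := (h.tendsto_time hq).eventually (hφ.eventually self_mem_nhdsWithin)
  have hlarge := (h.tendsto_amp_div hq hφ).eventually_ge_atTop ((M + 1) * (j + 1))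
  have hfr : ∃ᶠ n in atTop, ((M + 1 : ℝ) : EReal) ≤ ((1 / φ (time c q δ n) *
      |timeAverage c (fun w => ∑' n, f n w) (time c q δ n) z| : ℝ) : EReal) := by
    refine (Frequently.and_eventually hj (hpos.and hlarge)).mono ?_
    rintro n ⟨h1, h2, h3⟩
    have h1' : a n / (j + 1) ≤ timeAverage c (fun w => ∑' m, f m w) (time c q δ n) z := h1
    have h2' : 0 < φ (time c q δ n) := h2
    have hj0 : (0 : ℝ) < j + 1 := by positivity
    rw [EReal.coe_le_coe_iff]
    calc M + 1 ≤ a n / φ (time c q δ n) / (j + 1) := by rwa [le_div_iff₀ hj0]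
      _ = 1 / φ (time c q δ n) * (a n / (j + 1)) := by ring
      _ ≤ _ := by
        gcongr
        exact h1'.trans (le_abs_self _)
  have hlt : ((M : ℝ) : EReal) < ((M + 1 : ℝ) : EReal) := by
    rw [EReal.coe_lt_coe_iff]
    linarith
  exact hlt.trans_le (le_limsup_of_frequently_le ((h.tendsto_time hq).frequently hfr))

end Construction

/-! ### Functions on the torus supported in the parallelogram -/

section Push

variable {c : ℝ} {p : ℤ} {q : ℕ}

open Classical in
/-- The function on the torus that is given by `h` in the coordinates of the interior of `R` and
vanishes elsewhere. -/
noncomputable def push (c : ℝ) (p : ℤ) (q : ℕ) (h : ℝ × ℝ → ℝ) (z : Torus) : ℝ :=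
  if hz : ∃ w ∈ interior (parallelogram c p q), chart c w = z then h hz.choose else 0

lemma push_eq_zero {h : ℝ × ℝ → ℝ} {z : Torus}
    (hz : z ∉ chart c '' interior (parallelogram c p q)) : push c p q h z = 0 :=
  dif_neg hz

/-- By `chart_injective` the chosen preimage is `w` itself. A boundary point has no interior
preimage, which agrees with `h` vanishing there. -/
lemma push_chart (hq : 0 < q) (hpq : IsCoprime p (q : ℤ)) (hcpq : 0 < c - (p : ℝ) / q)
    {h : ℝ × ℝ → ℝ} (hh : ∀ w ∉ interior (parallelogram c p q), h w = 0) {w : ℝ × ℝ}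
    (hw : w ∈ parallelogram c p q) : push c p q h (chart c w) = h w := by
  by_cases hz : ∃ v ∈ interior (parallelogram c p q), chart c v = chart c w
  · rw [push, dif_pos hz,
      ← chart_injective hq hpq hcpq hw hz.choose_spec.1 hz.choose_spec.2.symm]
  · rw [push, dif_neg hz, hh w fun hw' => hz ⟨w, hw', rfl⟩]

lemma contDiff_unlift (c : ℝ) : ContDiff ℝ ∞ (unlift c) := by
  unfold unlift
  fun_prop

/-- Over the image of the interior of `R` the function is locally `h` composed with an affine map.
At any other point it vanishes on a neighbourhood, because the chart image of the compact set `S` is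
closed. -/
lemma contDiff_push (hq : 0 < q) (hpq : IsCoprime p (q : ℤ)) (hcpq : 0 < c - (p : ℝ) / q)
    {h : ℝ × ℝ → ℝ} (hc : ContDiff ℝ ∞ h) {S : Set (ℝ × ℝ)} (hS : IsCompact S)
    (hSR : S ⊆ interior (parallelogram c p q)) (hh : ∀ w ∉ S, h w = 0) :
    ContDiff ℝ ∞ fun v => push c p q h (proj v) := by
  have hh' : ∀ w ∉ interior (parallelogram c p q), h w = 0 := fun w hw =>
    hh w fun hwS => hw (hSR hwS)
  rw [contDiff_iff_contDiffAt]
  intro v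
  by_cases hv : proj v ∈ chart c '' interior (parallelogram c p q)
  · obtain ⟨w, hw, hwv⟩ := hv
    rw [← proj_lift, proj_eq_iff] at hwv
    obtain ⟨i, j, hij⟩ := hwv
    let T : ℝ × ℝ → ℝ × ℝ := fun v => unlift c (v.1 + i, v.2 + j)
    have hT : ContDiff ℝ ∞ T := (contDiff_unlift c).comp (by fun_prop)
    have hTv : T v = w := by
      simp only [T]
      rw [← hij, unlift_lift]
    have hchart : ∀ v, chart c (T v) = proj v := by
      intro v
      rw [← proj_lift, lift_unlift, proj_eq_iff]
      exact ⟨i, j, rfl⟩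
    refine (hc.comp hT).contDiffAt.congr_of_eventuallyEq ?_
    have hnhds : T ⁻¹' interior (parallelogram c p q) ∈ 𝓝 v :=
      (isOpen_interior.preimage hT.continuous).mem_nhds (by rwa [mem_preimage, hTv])
    filter_upwards [hnhds] with v' hv'
    rw [← hchart, push_chart hq hpq hcpq hh' (interior_subset hv')]
    rfl
  · refine (contDiffAt_const (c := (0 : ℝ))).congr_of_eventuallyEq ?_
    have hcl : IsClosed (chart c '' S) := (hS.image (continuous_chart c)).isClosed
    have hnhds : proj ⁻¹' (chart c '' S)ᶜ ∈ 𝓝 v :=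
      (hcl.isOpen_compl.preimage continuous_proj).mem_nhds fun h' =>
        hv (image_mono hSR h')
    filter_upwards [hnhds] with v' hv'
    by_cases hv'' : proj v' ∈ chart c '' interior (parallelogram c p q)
    · obtain ⟨w, hw, hwv⟩ := hv''
      rw [← hwv, push_chart hq hpq hcpq hh' (interior_subset hw)]
      exact hh w fun hwS => hv' ⟨w, hwS, hwv⟩
    · exact push_eq_zero hv''

end Push

/-! ### Existence of bumps -/

lemma exists_smooth_cutoff {ε : ℝ} (h0 : 0 < ε) (h1 : ε < 1 / 2) :
    ∃ θ : ℝ → ℝ, ContDiff ℝ ∞ θ ∧ (∀ s, 0 ≤ θ s) ∧ (∀ s, θ s ≤ 1) ∧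
      (∀ s ∈ Icc ε (1 - ε), θ s = 1) ∧ (∀ s ≤ ε / 2, θ s = 0) ∧ ∀ s, 1 - ε / 2 ≤ s → θ s = 0 := by
  let b : ContDiffBump (1 / 2 : ℝ) := ⟨1 / 2 - ε, 1 / 2 - ε / 2, by linarith, by linarith⟩
  refine ⟨b, b.contDiff, b.nonneg', fun s => b.le_one, fun s hs => ?_, fun s hs => ?_,
    fun s hs => ?_⟩
  · refine b.one_of_mem_closedBall ?_
    rw [Metric.mem_closedBall, Real.dist_eq, abs_le]
    simp only [b]
    constructor <;> linarith [hs.1, hs.2]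
  · refine b.zero_of_le_dist ?_
    rw [Real.dist_eq]
    exact le_trans (by simp only [b]; linarith) (neg_le_abs _)
  · refine b.zero_of_le_dist ?_
    rw [Real.dist_eq]
    exact le_trans (by simp only [b]; linarith) (le_abs_self _)

lemma integral_sub_shift_eq_zero {θ : ℝ → ℝ} (hθ : Continuous θ) (h0 : ∀ s ≤ 0, θ s = 0)
    (h1 : ∀ s, 1 ≤ s → θ s = 0) : ∫ s in (0 : ℝ)..4, (θ s - θ (s - 2)) = 0 := by
  have hi : ∀ a b, IntervalIntegrable θ volume a b := fun a b => hθ.intervalIntegrable a b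
  have hθ2 : Continuous fun s => θ (s - 2) := hθ.comp (by fun_prop)
  rw [intervalIntegral.integral_sub (hi _ _) (hθ2.intervalIntegrable _ _),
    intervalIntegral.integral_comp_sub_right θ 2,
    ← intervalIntegral.integral_add_adjacent_intervals (hi 0 2) (hi 2 4),
    ← intervalIntegral.integral_add_adjacent_intervals (hi (0 - 2) 0) (hi 0 (4 - 2))]
  have e1 : ∫ s in (2 : ℝ)..4, θ s = 0 := by
    rw [intervalIntegral.integral_congr (g := fun _ => 0), intervalIntegral.integral_zero]
    intro s hs
    rw [uIcc_of_le (by norm_num)] at hs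
    exact h1 s (by linarith [hs.1])
  have e2 : ∫ s in (0 - 2 : ℝ)..0, θ s = 0 := by
    rw [intervalIntegral.integral_congr (g := fun _ => 0), intervalIntegral.integral_zero]
    intro s hs
    rw [uIcc_of_le (by norm_num)] at hs
    exact h0 s hs.2
  rw [e1, e2]
  norm_num

lemma quarter_subset_parallelogram {c : ℝ} {p : ℤ} {q : ℕ} {i : ℕ} (hi : i ≤ 3) :
    quarter c p q i ⊆ parallelogram c p q := by
  have hℓ : 0 ≤ length c q / 4 := by
    unfold length
    positivity
  have hi' : (i : ℝ) + 1 ≤ 4 := by exact_mod_cast Nat.succ_le_succ hi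
  refine prod_mono_right (Icc_subset_Icc (by positivity) ?_)
  nlinarith

/-- The bump is a cutoff across the width times `θ(s) - θ(s - 2)` along the flow, where `s` is
measured in quarters of the length; the shift by two quarters makes the fibre integrals cancel. -/
lemma exists_isBump {c : ℝ} {p : ℤ} {q : ℕ} (hq : 0 < q) (hpq : IsCoprime p (q : ℤ))
    (hcpq : 0 < c - (p : ℝ) / q) (hβ : beta c p q < 1) {a ε : ℝ} (ha : 0 < a) (hε : 0 < ε)
    (hε' : ε < 1 / 2) :
    ∃ g, IsBump c p q a g ∧ ∃ K, IsCompact K ∧ K ⊆ interior (quarter c p q 0) ∧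
      (∀ w ∈ K, g (chart c w) = a) ∧
      (volume : Measure Torus).real (chart c '' K) =
        (1 - beta c p q) * (1 - 2 * ε) ^ 2 * (1 / 4) := by
  obtain ⟨θ, hθ, hθ0, hθ1, hθε, hθl, hθr⟩ := exists_smooth_cutoff hε hε'
  have hq' : (0 : ℝ) < q := by exact_mod_cast hq
  have hr := sqrt_one_add_sq_pos c
  have hw : 0 < width c p q := div_pos (by linarith) hq'
  have hℓ : 0 < length c q := mul_pos hq' hr
  have hwℓ : width c p q * length c q = (1 - beta c p q) * √(1 + c ^ 2) := by
    unfold width length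
    field_simp
  set w := width c p q with hwdef
  set ℓ := length c q with hℓdef
  have hl0 : ∀ s ≤ 0, θ s = 0 := fun s hs => hθl s (by linarith)
  have hr1 : ∀ s, 1 ≤ s → θ s = 0 := fun s hs => hθr s (by linarith)
  let h : ℝ × ℝ → ℝ := fun v => a * (θ (v.1 / w) * (θ (v.2 / (ℓ / 4)) - θ (v.2 / (ℓ / 4) - 2)))
  have hℓ4 : 0 < ℓ / 4 := by positivity
  have hh : ContDiff ℝ ∞ h := by
    refine contDiff_const.mul ((hθ.comp ?_).mul ((hθ.comp ?_).sub (hθ.comp ?_))) <;> fun_prop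
  -- The negative copy ends at `3 - ε / 2` quarters, so `7 / 2` leaves room on both sides.
  let S : Set (ℝ × ℝ) := Icc (ε / 2 * w) ((1 - ε / 2) * w) ×ˢ
    Icc (ε / 2 * (ℓ / 4)) (7 / 2 * (ℓ / 4))
  have hS : IsCompact S := isCompact_Icc.prod isCompact_Icc
  have hSR : S ⊆ interior (parallelogram c p q) := by
    rw [interior_parallelogram]
    refine prod_mono (Icc_subset_Ioo (by positivity) ?_) (Icc_subset_Ioo (by positivity) ?_)
    · rw [← hwdef]
      nlinarith
    · rw [← hℓdef]
      linarith
  have hh0 : ∀ v ∉ S, h v = 0 := by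
    rintro ⟨x, y⟩ hv
    simp only [S, mem_prod, mem_Icc, not_and_or, not_le] at hv
    simp only [h]
    rcases hv with (hv | hv) | (hv | hv)
    · rw [hθl (x / w) (by rw [div_le_iff₀ hw]; exact hv.le)]
      simp
    · rw [hθr (x / w) (by rw [le_div_iff₀ hw]; exact hv.le)]
      simp
    · have : y / (ℓ / 4) ≤ ε / 2 := by rw [div_le_iff₀ hℓ4]; exact hv.le
      rw [hθl _ this, hθl (y / (ℓ / 4) - 2) (by linarith)]
      simp
    · have : 7 / 2 ≤ y / (ℓ / 4) := by rw [le_div_iff₀ hℓ4]; exact hv.le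
      rw [hθr (y / (ℓ / 4)) (by linarith), hθr (y / (ℓ / 4) - 2) (by linarith)]
      simp
  have hh0' : ∀ v ∉ interior (parallelogram c p q), h v = 0 := fun v hv =>
    hh0 v fun hvS => hv (hSR hvS)
  have hpush : ∀ v ∈ parallelogram c p q, push c p q h (chart c v) = h v := fun v hv =>
    push_chart hq hpq hcpq hh0' hv
  have hhabs : ∀ v, |h v| ≤ a := by
    intro v
    simp only [h]
    rw [abs_mul, abs_of_pos ha, abs_mul, abs_of_nonneg (hθ0 _)]
    refine mul_le_of_le_one_right ha.le (mul_le_one₀ (hθ1 _) (abs_nonneg _) ?_)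
    rw [abs_le]
    constructor
    · linarith [hθ0 (v.2 / (ℓ / 4)), hθ1 (v.2 / (ℓ / 4) - 2)]
    · linarith [hθ1 (v.2 / (ℓ / 4)), hθ0 (v.2 / (ℓ / 4) - 2)]
  have hquart : ∀ (i : ℕ) (v : ℝ × ℝ), v ∈ quarter c p q i →
      (i : ℝ) ≤ v.2 / (ℓ / 4) ∧ v.2 / (ℓ / 4) ≤ i + 1 := by
    rintro i v ⟨-, h1, h2⟩
    exact ⟨by rwa [le_div_iff₀ hℓ4], by rwa [div_le_iff₀ hℓ4]⟩
  have hfirst : ∀ v ∈ quarter c p q 0, h v = a * (θ (v.1 / w) * θ (v.2 / (ℓ / 4))) := by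
    intro v hv
    have := hquart 0 v hv
    simp only [h]
    rw [hl0 (v.2 / (ℓ / 4) - 2) (by push_cast at this; linarith), sub_zero]
  refine ⟨push c p q h, ?_, ?_⟩
  · refine ⟨contDiff_push hq hpq hcpq hh hS hSR hh0, fun z => ?_, fun z hz => push_eq_zero hz,
      fun v hv => ?_, fun v hv => ?_, fun v hv => ?_, fun v hv => ?_, fun x hx => ?_⟩
    · by_cases hz : z ∈ chart c '' interior (parallelogram c p q)
      · obtain ⟨v, hv, rfl⟩ := hz
        rw [hpush v (interior_subset hv)]
        exact hhabs v
      · rw [push_eq_zero hz, abs_zero]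
        exact ha.le
    · rw [hpush v (quarter_subset_parallelogram (by norm_num) hv), hfirst v hv]
      exact mul_nonneg ha.le (mul_nonneg (hθ0 _) (hθ0 _))
    · have := hquart 1 v hv
      push_cast at this
      rw [hpush v (quarter_subset_parallelogram (by norm_num) hv)]
      simp only [h]
      rw [hr1 _ this.1, hl0 (v.2 / (ℓ / 4) - 2) (by linarith)]
      simp
    · have hvR := quarter_subset_parallelogram (by norm_num) hv
      have := hquart 0 v hv
      push_cast at this
      have hv' : (v.1, v.2 + ℓ / 2) ∈ parallelogram c p q := by
        rw [quarter_zero] at hv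
        refine ⟨hv.1, ?_, ?_⟩
        · have := hv.2.1
          simp only
          linarith
        · have := hv.2.2
          simp only
          linarith
      rw [hpush v hvR, hpush _ hv', hfirst v hv]
      simp only [h]
      have e : (v.2 + ℓ / 2) / (ℓ / 4) = v.2 / (ℓ / 4) + 2 := by
        field_simp
        ring
      rw [e, add_sub_cancel_right, hr1 (v.2 / (ℓ / 4) + 2) (by linarith)]
      ring
    · have := hquart 3 v hv
      push_cast at this
      rw [hpush v (quarter_subset_parallelogram (by norm_num) hv)]
      simp only [h]
      rw [hr1 (v.2 / (ℓ / 4)) (by linarith), hr1 (v.2 / (ℓ / 4) - 2) (by linarith)]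
      simp
    · have e : ∀ y ∈ uIcc 0 ℓ, push c p q h (chart c (x, y)) =
          a * θ (x / w) * (θ (y / (ℓ / 4)) - θ (y / (ℓ / 4) - 2)) := by
        intro y hy
        rw [uIcc_of_le hℓ.le] at hy
        rw [hpush (x, y) ⟨hx, hy⟩]
        simp only [h]
        ring
      rw [intervalIntegral.integral_congr e, intervalIntegral.integral_const_mul,
        intervalIntegral.integral_comp_div (fun s => θ s - θ (s - 2)) hℓ4.ne', zero_div,
        show ℓ / (ℓ / 4) = 4 by field_simp, integral_sub_shift_eq_zero hθ.continuous hl0 hr1]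
      simp
  · let K : Set (ℝ × ℝ) := Icc (ε * w) ((1 - ε) * w) ×ˢ Icc (ε * (ℓ / 4)) ((1 - ε) * (ℓ / 4))
    have hKQ : K ⊆ interior (quarter c p q 0) := by
      rw [quarter_zero, interior_prod_eq, interior_Icc, interior_Icc]
      refine prod_mono (Icc_subset_Ioo (by positivity) ?_) (Icc_subset_Ioo (by positivity) ?_)
      · rw [← hwdef]
        nlinarith
      · rw [← hℓdef]
        nlinarith
    have hKR : K ⊆ interior (parallelogram c p q) :=
      hKQ.trans (interior_mono (quarter_subset_parallelogram (by norm_num)))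
    refine ⟨K, isCompact_Icc.prod isCompact_Icc, hKQ, fun v hv => ?_, ?_⟩
    · rw [hpush v (interior_subset (hKR hv)), hfirst v (interior_subset (hKQ hv))]
      obtain ⟨⟨hx1, hx2⟩, hy1, hy2⟩ := hv
      rw [hθε (v.1 / w) ⟨by rwa [le_div_iff₀ hw], by rwa [div_le_iff₀ hw]⟩,
        hθε (v.2 / (ℓ / 4)) ⟨by rwa [le_div_iff₀ hℓ4], by rwa [div_le_iff₀ hℓ4]⟩]
      ring
    · rw [measureReal_def, volume_chart_rect c (by nlinarith) fun v hv v' hv' hvv' =>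
        chart_injective hq hpq hcpq (interior_subset (hKR hv)) (hKR hv') hvv',
        ENNReal.toReal_ofReal]
      · calc ((1 - ε) * w - ε * w) * ((1 - ε) * (ℓ / 4) - ε * (ℓ / 4)) / √(1 + c ^ 2)
            = (w * ℓ) * (1 - 2 * ε) ^ 2 * (1 / 4) / √(1 + c ^ 2) := by ring
          _ = _ := by
            rw [hwℓ]
            field_simp
      · have h1 : 0 ≤ (1 - ε) * w - ε * w := by nlinarith
        have h2 : 0 ≤ (1 - ε) * (ℓ / 4) - ε * (ℓ / 4) := by nlinarith
        positivity

/-! ### Existence of the construction -/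

section Approximation

variable {c : ℝ} {p : ℕ → ℤ} {q : ℕ → ℕ}

lemma IsApproximation.tendsto_beta (h : IsApproximation c p q) :
    Tendsto (fun n => beta c (p n) (q n)) atTop (𝓝 0) := by
  refine h.isLittleO.tendsto_div_nhds_zero.congr fun n => ?_
  rw [beta, div_div_eq_mul_div, div_one, mul_comm]

/-- If `q n = m`, then `β_n = m (m c - p n)` is at least the fractional part of `m c`, positive by
irrationality. As `β_n → 0`, each value `m` occurs only finitely often. -/
lemma IsApproximation.tendsto_denominators (hc : Irrational c) (h : IsApproximation c p q) :
    Tendsto q atTop atTop := by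
  have key : ∀ m : ℕ, ∀ᶠ n in atTop, q n ≠ m := by
    intro m
    rcases Nat.eq_zero_or_pos m with rfl | hm
    · exact Eventually.of_forall fun n => (h.pos n).ne'
    have hirr : Irrational (m * c) := hc.natCast_mul hm.ne'
    have hfr : 0 < Int.fract (m * c) := by
      refine (Int.fract_nonneg _).lt_of_ne' fun h0 => ?_
      exact hirr ⟨⌊m * c⌋, by
        have := Int.self_sub_floor (m * c)
        rw [h0] at this
        push_cast
        linarith⟩
    filter_upwards [h.tendsto_beta.eventually (gt_mem_nhds hfr)] with n hn hnm
    have hm' : (1 : ℝ) ≤ m := by exact_mod_cast hm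
    have hβ : beta c (p n) (q n) = m * (m * c - p n) := by
      rw [beta, hnm]
      field_simp
    have hpos := beta_pos (h.pos n) (h.lt n)
    rw [hβ] at hn hpos
    have hd : 0 < m * c - p n := pos_of_mul_pos_right hpos (by positivity)
    have hfl : (p n : ℝ) ≤ ⌊m * c⌋ := by
      exact_mod_cast Int.le_floor.2 (by linarith : (p n : ℝ) ≤ m * c)
    have hfle : Int.fract (m * c) ≤ m * c - p n := by
      rw [← Int.self_sub_floor]
      linarith
    nlinarith
  rw [tendsto_atTop]
  intro N
  have hall : ∀ᶠ n in atTop, ∀ m ∈ Finset.range N, q n ≠ m :=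
    (eventually_all_finset _).2 fun m _ => key m
  filter_upwards [hall] with n hn
  by_contra hcon
  exact hn (q n) (Finset.mem_range.2 (not_le.1 hcon)) rfl

/-- A sequence can be chosen so that each term satisfies an eventual condition that depends on its
index and on the preceding term. -/
lemma exists_strictMono_forall {P : ℕ → ℕ → ℕ → Prop} (h : ∀ n j, ∀ᶠ i in atTop, P n j i) :
    ∃ k : ℕ → ℕ, StrictMono k ∧ P 0 0 (k 0) ∧ ∀ n, P (n + 1) (k n) (k (n + 1)) := by
  have h' : ∀ n j, ∃ i, j < i ∧ P n j i := fun n j => ((eventually_gt_atTop j).and (h n j)).exists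
  choose g hg hP using h'
  let k : ℕ → ℕ := fun n => Nat.rec (g 0 0) (fun n j => g (n + 1) j) n
  exact ⟨k, strictMono_nat_of_lt_succ fun n => hg (n + 1) (k n), hP 0 0,
    fun n => hP (n + 1) (k n)⟩

lemma sum_comp_le_of_strictMono {k : ℕ → ℕ} (hk : StrictMono k) (n : ℕ) :
    ∑ m ∈ Finset.range (n + 1), (q (k m) : ℝ) ≤ ∑ m ∈ Finset.range (k n + 1), (q m : ℝ) := by
  rw [← Finset.sum_image (f := fun m => (q m : ℝ)) hk.injective.injOn]
  refine Finset.sum_le_sum_of_subset_of_nonneg ?_ fun _ _ _ => by positivity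
  intro i hi
  obtain ⟨m, hm, rfl⟩ := Finset.mem_image.1 hi
  rw [Finset.mem_range] at hm ⊢
  exact Nat.lt_succ_of_le (hk.monotone (Nat.le_of_lt_succ hm))

/-! ### Amplitudes and choice of the subsequence -/

/-- The amplitudes of the construction. -/
noncomputable def amplitude (n : ℕ) : ℝ := (1 / 2) ^ n ^ 2

lemma amplitude_pos (n : ℕ) : 0 < amplitude n := by
  unfold amplitude
  positivity

/-- It rests on `(n + 1 + m)² ≥ n² + n + 1 + m`; the geometric factor in `m` makes the tail summable
with ratio at most `2^(-n)`. -/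
lemma amplitude_add_le (n m : ℕ) :
    amplitude (n + 1 + m) ≤ amplitude n * (1 / 2) ^ n * ((1 / 2) * (1 / 2) ^ m) := by
  unfold amplitude
  rw [← pow_succ', ← pow_add, ← pow_add]
  refine pow_le_pow_of_le_one (by norm_num) (by norm_num) ?_
  nlinarith [Nat.zero_le (n * m), Nat.zero_le n, Nat.zero_le m, Nat.zero_le (m * m)]

lemma summable_amplitude_tail (n : ℕ) : Summable fun m => amplitude (n + 1 + m) :=
  Summable.of_nonneg_of_le (fun _ => (amplitude_pos _).le) (amplitude_add_le n)
    ((summable_geometric_two.mul_left _).mul_left _)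

lemma summable_amplitude : Summable amplitude := by
  have h := summable_amplitude_tail 0
  simp_rw [zero_add, add_comm 1] at h
  exact (summable_nat_add_iff 1).1 h

lemma tailRatio_amplitude_le (n : ℕ) : tailRatio amplitude n ≤ (1 / 2) ^ n := by
  rw [tailRatio, div_le_iff₀ (amplitude_pos n), mul_comm]
  refine ((summable_amplitude_tail n).tsum_le_tsum (amplitude_add_le n)
    ((summable_geometric_two.mul_left _).mul_left _)).trans_eq ?_
  rw [tsum_mul_left, tsum_mul_left, tsum_geometric_two]
  ring

/-- The first term of the tail bounds it from below, so the rate condition follows from an upper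
bound on `φ(t_n)` in terms of `amplitude (n + 1)`. -/
lemma amplitude_succ_le (n : ℕ) :
    amplitude (n + 1) ≤ amplitude n * tailRatio amplitude n := by
  rw [tailRatio, mul_div_cancel₀ _ (amplitude_pos n).ne']
  exact (summable_amplitude_tail n).le_tsum 0 fun m _ => (amplitude_pos _).le

lemma tendsto_tailRatio_amplitude : Tendsto (tailRatio amplitude) atTop (𝓝 0) :=
  squeeze_zero (fun n => div_nonneg (tsum_nonneg fun m => (amplitude_pos _).le)
    (amplitude_pos n).le) tailRatio_amplitude_le
    (tendsto_pow_atTop_nhds_zero_of_lt_one (by norm_num) (by norm_num))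

lemma exists_isConstruction (hc : Irrational c) (h : IsApproximation c p q) {φ : ℝ → ℝ}
    (hφ : Tendsto φ atTop (𝓝[>] 0)) :
    ∃ k : ℕ → ℕ, StrictMono k ∧ ∃ (a δ : ℕ → ℝ) (f : ℕ → Torus → ℝ),
      IsConstruction c (p ∘ k) (q ∘ k) φ a δ f := by
  have hr := sqrt_one_add_sq_pos c
  let δ : ℕ → ℝ := fun n => 1 / ((n : ℝ) + 1)
  have hδ : ∀ n, 0 < δ n := fun n => by positivity
  have hqR : Tendsto (fun i => (q i : ℝ)) atTop atTop :=
    tendsto_natCast_atTop_atTop.comp (h.tendsto_denominators hc)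
  -- Here `j` is the preceding chosen index. Summing all denominators up to `j` dominates the sum
  -- over the chosen ones, so the condition needs no further history; the bound on `β` keeps it
  -- below `1`.
  let P : ℕ → ℕ → ℕ → Prop := fun n j i => beta c (p i) (q i) < 1 / ((n : ℝ) + 2) ∧
    (∑ m ∈ Finset.range (j + 1), (q m : ℝ)) / (q i * amplitude n * δ n) < 1 / ((n : ℝ) + 1) ∧
    0 < φ (δ n * q i * √(1 + c ^ 2)) ∧
    φ (δ n * q i * √(1 + c ^ 2)) < amplitude (n + 1) / ((n : ℝ) + 1)
  have hP : ∀ n j, ∀ᶠ i in atTop, P n j i := by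
    intro n j
    have t1 : Tendsto (fun i => (∑ m ∈ Finset.range (j + 1), (q m : ℝ)) /
        (q i * amplitude n * δ n)) atTop (𝓝 0) :=
      ((hqR.atTop_mul_const (amplitude_pos n)).atTop_mul_const (hδ n)).const_div_atTop _
    have t2 : Tendsto (fun i => φ (δ n * q i * √(1 + c ^ 2))) atTop (𝓝[>] 0) :=
      hφ.comp ((hqR.const_mul_atTop (hδ n)).atTop_mul_const hr)
    have t3 := tendsto_nhdsWithin_iff.1 t2
    have hpos : 0 < amplitude (n + 1) / ((n : ℝ) + 1) := div_pos (amplitude_pos _) (by positivity)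
    exact (h.tendsto_beta.eventually (gt_mem_nhds (by positivity))).and
      ((t1.eventually (gt_mem_nhds (by positivity))).and
        (t3.2.and (t3.1.eventually (gt_mem_nhds hpos))))
  obtain ⟨k, hk, hk0, hkn⟩ := exists_strictMono_forall hP
  have hβ : ∀ n, beta c (p (k n)) (q (k n)) < 1 / ((n : ℝ) + 2) := by
    rintro (_ | n)
    exacts [hk0.1, (hkn n).1]
  have hφk : ∀ n, 0 < φ (time c (q ∘ k) δ n) ∧
      φ (time c (q ∘ k) δ n) < amplitude (n + 1) / ((n : ℝ) + 1) := by
    rintro (_ | n)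
    exacts [hk0.2.2, (hkn n).2.2]
  have hβ1 : ∀ n, beta c (p (k n)) (q (k n)) < 1 := fun n => (hβ n).trans_le (by
    rw [div_le_one (by positivity)]
    linarith [(n.cast_nonneg : (0 : ℝ) ≤ n)])
  have hε : ∀ n : ℕ, 1 / ((n : ℝ) + 3) < 1 / 2 := fun n => by
    gcongr
    linarith [(n.cast_nonneg : (0 : ℝ) ≤ n)]
  have hden : ∀ n, 0 < (q (k n) : ℝ) * amplitude n * δ n := fun n =>
    mul_pos (mul_pos (by exact_mod_cast h.pos _) (amplitude_pos n)) (hδ n)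
  choose f hf K hK using fun n => exists_isBump (h.pos (k n)) (h.coprime (k n)) (h.lt (k n))
    (hβ1 n) (amplitude_pos n) (show (0 : ℝ) < 1 / ((n : ℝ) + 3) by positivity) (hε n)
  refine ⟨k, hk, amplitude, δ, f, amplitude_pos, summable_amplitude, tendsto_tailRatio_amplitude,
    hδ, tendsto_one_div_add_atTop_nhds_zero_nat, ?_, ?_, hf, K,
    fun n => ⟨(hK n).1, (hK n).2.1, (hK n).2.2.1⟩, ?_⟩
  · refine squeeze_zero (fun n => div_nonneg (by positivity) (hden n).le) ?_
      tendsto_one_div_add_atTop_nhds_zero_nat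
    -- For `n = 0` the sum over earlier denominators is empty, so the dummy predecessor `0` is
    -- harmless.
    rintro (_ | n)
    · simp
    · refine le_trans ?_ (hkn n).2.1.le
      exact div_le_div_of_nonneg_right (sum_comp_le_of_strictMono hk n) (hden (n + 1)).le
  · refine tendsto_atTop_mono (fun n => ?_) tendsto_natCast_atTop_atTop
    obtain ⟨h1, h2⟩ := hφk n
    rw [le_div_iff₀ h1]
    rw [lt_div_iff₀ (by positivity)] at h2
    have := amplitude_succ_le n
    linarith
  · simp_rw [fun n => (hK n).2.2.2]
    have t1 : Tendsto (fun n => beta c (p (k n)) (q (k n))) atTop (𝓝 0) :=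
      h.tendsto_beta.comp hk.tendsto_atTop
    have t2 : Tendsto (fun n : ℕ => 1 / ((n : ℝ) + 3)) atTop (𝓝 0) :=
      (tendsto_atTop_add_const_right _ 3 tendsto_natCast_atTop_atTop).const_div_atTop 1
    simpa only [mul_zero, sub_zero, one_pow, one_mul] using
      ((t1.const_sub 1).mul (((t2.const_mul 2).const_sub 1).pow 2)).mul_const (1 / 4)

end Approximation

end TorusWinding

theorem theorem4 (c : ℝ) (hc : Irrational c) (p : ℕ → ℤ) (q : ℕ → ℕ)
    (hpq : TorusWinding.IsApproximation c p q)
    (φ : ℝ → ℝ) (hφ : Tendsto φ atTop (𝓝[>] 0)) :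
    (∃ k : ℕ → ℕ, StrictMono k ∧ ∃ (a δ : ℕ → ℝ) (f : ℕ → TorusWinding.Torus → ℝ),
      TorusWinding.IsConstruction c (p ∘ k) (q ∘ k) φ a δ f) ∧
    (∀ (a δ : ℕ → ℝ) (f : ℕ → TorusWinding.Torus → ℝ),
      TorusWinding.IsConstruction c p q φ a δ f →
        Continuous (fun z => ∑' n, f n z) ∧
        ∀ᵐ z : TorusWinding.Torus,
          limsup (fun t : ℝ =>
            ((1 / φ t * |TorusWinding.timeAverage c (fun w => ∑' n, f n w) t z| : ℝ) : EReal))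
            atTop = ⊤) := by
  refine ⟨TorusWinding.exists_isConstruction hc hpq hφ, fun a δ f h => ⟨h.continuous_tsum, ?_⟩⟩
  filter_upwards [h.ae_mem_divergent hc hpq] with z hz using h.limsup_eq_top hpq.pos hφ hz
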